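/- **Proposition 4.4.** Let $q\ge 3$, let $T$ be a $q$-regular tree with root $\rho$, and equip $\mathrm{Aut}(T)$ with the topology of pointwise convergence on vertices. Let $G\subset\mathrm{Aut}(T)$ be a closed subgroup whose Poincaré exponent $$\delta(G\curvearrowright T)=\inf\Big\{s>0:\ \sum_{w\in G\cdot \rho}\exp(-s\,d(\rho,w))<+\infty\Big\}$$ equals $\log(q-1)$. Let $\mu_0,\mu_1$ be equivalent (mutually absolutely continuous) probability measures on a standard Borel space $X_0$, and let $$H^2(\mu_0,\mu_1)=\frac12\int_{X_0}\Big(\sqrt{d\mu_0/d\zeta}-\sqrt{d\mu_1/d\zeta}\Big)^2d\zeta ,$$ where $\zeta$ is any finite measure dominating $\mu_0$ and $\mu_1$. Let $E\subset V(T)\times V(T)$ be the set of oriented edges of $T$, and for $e\in E$ put $\mu_e=\mu_0$ if $e$ is oriented towards $\rho$ and $\mu_e=\mu_1$ if $e$ is oriented away from $\rho$. Consider the generalized Bernoulli action $$G\curvearrowright (X,\mu)=\prod_{e\in E}(X_0,\mu_e),\qquad (g\cdot x)_e=x_{g^{-1}\cdot e}.$$ If $1-H^2(\mu_0,\mu_1)=(q-1)^{-1/2}$,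 then this action is nonsingular and dissipative up to compact stabilizers: in its ergodic decomposition, almost every ergodic component is conjugate, as a nonsingular action, to the translation action $G\curvearrowright G/K$ for some compact subgroup $K\subset G$ (depending on the component), where $G/K$ carries its invariant measure class. -/

import Mathlib

open MeasureTheory ProbabilityTheory
open scoped ENNReal

noncomputable section

namespace TreeBernoulli

/-! ### Nonsingular actions and dissipativity up to compact stabilizers -/

section Actions

variable (G : Type*) [Group G] [TopologicalSpace G] [MeasurableSpace G]

/-- The action of `G` on `(X, μ)` is a Borel action that preserves the measure class of `μ`. -/
structure IsNonsingularAction {X : Type*} [MeasurableSpace X] [MulAction G X]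
    (μ : Measure X) : Prop where
  measurable_smul : Measurable fun p : G × X => p.1 • p.2
  quasi_invariant : ∀ g : G, μ.map (fun x => g • x) ≪ μ

/-- Every `G`-invariant Borel set is null or conull. -/
def IsErgodicAction {X : Type*} [MeasurableSpace X] [MulAction G X] (μ : Measure X) : Prop :=
  ∀ A : Set X, MeasurableSet A → (∀ g : G, (fun x => g • x) ⁻¹' A = A) → μ A = 0 ∨ μ Aᶜ = 0

/-- `φ` is a nonsingular isomorphism `(X, μ) → (Y, ν)`: it is a Borel map, it is bijective between
conull Borel sets, and `φ_* μ` is equivalent to `ν`. -/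
structure IsNonsingularIso {X Y : Type*} [MeasurableSpace X] [MeasurableSpace Y]
    (φ : X → Y) (μ : Measure X) (ν : Measure Y) : Prop where
  measurable : Measurable φ
  map_ac : μ.map φ ≪ ν
  ac_map : ν ≪ μ.map φ
  bijOn : ∃ (A : Set X) (B : Set Y), MeasurableSet A ∧ MeasurableSet B ∧
    μ Aᶜ = 0 ∧ ν Bᶜ = 0 ∧ Set.BijOn φ A B

/-- The actions of `G` on `(X, μ)` and on `(Y, ν)` are conjugate, as nonsingular actions. -/
def IsConjugate {X Y : Type*} [MeasurableSpace X] [MeasurableSpace Y]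
    [MulAction G X] [MulAction G Y] (μ : Measure X) (ν : Measure Y) : Prop :=
  ∃ φ : X → Y, IsNonsingularIso φ μ ν ∧ ∀ g : G, ∀ᵐ x ∂μ, φ (g • x) = g • φ x

/-- The action of `G` on `(X, μ)` is of the form `G ↷ G ⧸ K` for a compact subgroup `K`. Here
`G ⧸ K` carries the translation action and its invariant measure class, which is the class of the
image of a (left) Haar measure of `G`. -/
def IsCompactCosetAction {X : Type*} [MeasurableSpace X] [MulAction G X]
    (μ : Measure X) : Prop :=
  ∃ K : Subgroup G, IsCompact (K : Set G) ∧ ∃ haar : Measure G, haar.IsHaarMeasure ∧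
    IsConjugate G μ (haar.map (QuotientGroup.mk : G → G ⧸ K))

/-- `π : X → Y` and `κ` form an ergodic decomposition of the action of `G` on the probability space
`(X, μ)`: the map `π` is Borel and invariant, `μ` disintegrates over `π` as
`μ = ∫ κ y d(π_* μ)(y)` where `κ y` is a probability measure that lives on the fibre `π⁻¹(y)`, and
for almost every `y` the action of `G` on `(X, κ y)` (an ergodic component) is nonsingular and
ergodic. -/
structure IsErgodicDecomposition {X Y : Type*} [MeasurableSpace X] [MeasurableSpace Y]
    [MulAction G X] (μ : Measure X) (π : X → Y) (κ : Kernel Y X) : Prop where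
  measurable : Measurable π
  invariant : ∀ (g : G) (x : X), π (g • x) = π x
  isMarkov : IsMarkovKernel κ
  bind_eq : (μ.map π).bind κ = μ
  fibre : ∀ᵐ y ∂(μ.map π), κ y (π ⁻¹' {y})ᶜ = 0
  nonsingular : ∀ᵐ y ∂(μ.map π), IsNonsingularAction G (κ y)
  ergodic : ∀ᵐ y ∂(μ.map π), IsErgodicAction G (κ y)

/-- The action of `G` on the standard probability space `(X, μ)` is nonsingular and dissipative up
to compact stabilizers: in its ergodic decomposition (over a standard Borel space, unique up to null
sets) almost every ergodic component is of the form `G ↷ G ⧸ K` with `K` a compact subgroup. -/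
def IsDissipativeUpToCompactStabilizers {X : Type*} [MeasurableSpace X] [MulAction G X]
    (μ : Measure X) : Prop :=
  IsNonsingularAction G μ ∧
  ∃ (Y : Type) (_ : MeasurableSpace Y) (_ : StandardBorelSpace Y) (π : X → Y) (κ : Kernel Y X),
    IsErgodicDecomposition G μ π κ ∧ ∀ᵐ y ∂(μ.map π), IsCompactCosetAction G (κ y)

end Actions

/-! ### Hellinger distance -/

/-- The squared Hellinger distance `H²(ν, η) = ½ ∫ (√(dν/dζ) - √(dη/dζ))² dζ`, computed with the
dominating measure `ζ = ν + η` (the value does not depend on the dominating measure). -/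
def hellingerSq {Y : Type*} [MeasurableSpace Y] (ν η : Measure Y) : ℝ :=
  (1 / 2) * ∫ y, (√((ν.rnDeriv (ν + η) y).toReal) - √((η.rnDeriv (ν + η) y).toReal)) ^ 2 ∂(ν + η)

/-! ### Automorphism groups of trees -/

section Tree

variable {V : Type*} {T : SimpleGraph V}

/-- The topology of pointwise convergence on `Aut(T)` (the vertex set being discrete). -/
instance autTopologicalSpace : TopologicalSpace (T ≃g T) :=
  TopologicalSpace.induced (fun (g : T ≃g T) (v : V) => g v)
    (@Pi.topologicalSpace V (fun _ => V) (fun _ => ⊥))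

/-- The Borel σ-algebra of `Aut(T)`. -/
instance autMeasurableSpace : MeasurableSpace (T ≃g T) := borel _

instance autBorelSpace : BorelSpace (T ≃g T) := ⟨rfl⟩

/-- The action of `Aut(T)` on oriented edges: `g • (v, w) = (g v, g w)`. -/
instance autMulActionDart : MulAction (T ≃g T) T.Dart where
  smul g e := ⟨(g e.fst, g e.snd), g.map_adj_iff.2 e.adj⟩
  one_smul _ := rfl
  mul_smul _ _ _ := rfl

/-- The action of `Aut(T)` on families indexed by the oriented edges: `(g • x)_e = x_{g⁻¹ • e}`. -/
instance autMulActionConfig {X₀ : Type*} : MulAction (T ≃g T) (T.Dart → X₀) where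
  smul g x := fun e => x (g⁻¹ • e)
  one_smul x := funext fun e => congrArg x (by rw [inv_one, one_smul])
  mul_smul g h x := funext fun e => congrArg x (by rw [mul_inv_rev, mul_smul])

/-- The Poincaré exponent of `G ⊂ Aut(T)`, computed at the vertex `v`: the infimum of all `s > 0`
for which `∑_{w ∈ G · v} exp(-s d(v, w)) < ∞`. -/
def poincareExponent (G : Subgroup (T ≃g T)) (v : V) : ℝ :=
  sInf {s : ℝ | 0 < s ∧
    Summable fun w : MulAction.orbit G v => Real.exp (-s * (T.dist v (w : V) : ℝ))}

open Classical in
/-- The measure `μ_e`: it is `μ₀` if the oriented edge `e` (in a tree) points towards the root `ρ`,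
and `μ₁` if it points away from `ρ`. -/
def edgeMeasure {X₀ : Type*} [MeasurableSpace X₀] (ρ : V) (μ₀ μ₁ : Measure X₀) (e : T.Dart) :
    Measure X₀ :=
  if T.dist ρ e.snd < T.dist ρ e.fst then μ₀ else μ₁

instance isProbabilityMeasure_edgeMeasure {X₀ : Type*} [MeasurableSpace X₀] (ρ : V)
    (μ₀ μ₁ : Measure X₀) [IsProbabilityMeasure μ₀] [IsProbabilityMeasure μ₁] (e : T.Dart) :
    IsProbabilityMeasure (edgeMeasure ρ μ₀ μ₁ e) := by
  unfold edgeMeasure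
  split_ifs <;> infer_instance

variable (T) in
/-- The product measure `∏_{e ∈ E(T)} μ_e` on `X₀ ^ E(T)`. -/
def bernoulliMeasure {X₀ : Type*} [MeasurableSpace X₀] (ρ : V) (μ₀ μ₁ : Measure X₀)
    [IsProbabilityMeasure μ₀] [IsProbabilityMeasure μ₁] : Measure (T.Dart → X₀) :=
  Measure.infinitePi fun e : T.Dart => edgeMeasure ρ μ₀ μ₁ e

end Tree

end TreeBernoulli

end

open scoped NNReal

noncomputable section

namespace TreeBernoulli

/-! Write `d = q - 1` and let `f` be a nowhere vanishing version of dμ₁/dμ₀. Translating by `g`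
moves the root from `ρ` to `g ρ`, which reverses only the orientations along the geodesic between
them. So the Radon–Nikodym derivative of the translated measure is the product of `f (x (v, u)) / f
(x (u, v))` over the steps of that geodesic; this is `weight ρ (g ρ)`, a cocycle defined for every
`x`.

Dissipativity follows once these weights are almost surely summable. If `S x` is their sum over the
orbit of `ρ`, then `ω = 1 / S` has Haar integral one along each orbit where `S` is finite. Such a
normalized weight gives every point a probability measure on its orbit that depends only on the
orbit. These measures are a Borel invariant separating orbits, and disintegrating over it gives
components living on single orbits (`isDissipative_of_weight`). An element fixing `x` sends `ρ` to a
vertex of weight 1, and summability leaves finitely many of those, so stabilizers are compact.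

Summability is proved over the whole tree (`ae_tsum_weight_ne_top`). A step away from the root has a
factor Y with E[Y] = 1 and, by the Hellinger condition, d E[√Y] = 1. The sum of √weight over a
sphere therefore has bounded mean, but the sum of the weights has mean of order dⁿ, so a direct
first moment fails. Instead √weight is killed when it exceeds a level `L`. Conservation of the mean
shows that some killing happens with probability at most 2/L. For the killed chain the concave
function z(A - z) decreases in mean by a multiple of z², so the expected sum of squares is finite.
Off the killing event the squares are the weights, and `L` tends to infinity. Only one-vertex
marginals are used, never the dependence between branches. -/

set_option linter.unusedSectionVars false

/-! ### A countable π-system that determines finite measures. -/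

section Generate

/-- A countable family of Borel sets generating the σ-algebra of a standard Borel space. -/
def genSet (X : Type*) [MeasurableSpace X] [StandardBorelSpace X] (r : ℚ) : Set X :=
  embeddingReal X ⁻¹' Set.Iic (r : ℝ)

variable {X : Type*} [MeasurableSpace X] [StandardBorelSpace X]

lemma measurableSet_genSet (r : ℚ) : MeasurableSet (genSet X r) :=
  (measurableEmbedding_embeddingReal X).measurable measurableSet_Iic

lemma generateFrom_genSet :
    ‹MeasurableSpace X› = MeasurableSpace.generateFrom (Set.range (genSet X)) := by
  refine (measurableEmbedding_embeddingReal X).comap_eq.symm.trans ?_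
  rw [BorelSpace.measurable_eq (α := ℝ), Real.borel_eq_generateFrom_Iic_rat,
    MeasurableSpace.comap_generateFrom]
  congr 1
  ext s
  simp [genSet]

lemma isPiSystem_genSet : IsPiSystem (Set.range (genSet X)) := by
  rintro _ ⟨r, rfl⟩ _ ⟨s, rfl⟩ -
  refine ⟨min r s, ?_⟩
  ext x
  simp [genSet]

lemma measure_ext_genSet {μ ν : Measure X} [IsFiniteMeasure μ]
    (h : ∀ r, μ (genSet X r) = ν (genSet X r)) (hu : μ Set.univ = ν Set.univ) : μ = ν :=
  ext_of_generate_finite _ generateFrom_genSet isPiSystem_genSet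
    (by rintro _ ⟨r, rfl⟩; exact h r) hu

end Generate

/-! ### Measures on orbits obtained from Haar measure and a weight. -/

section OrbitMeasure

variable {G : Type*} [Group G] [MeasurableSpace G] [MeasurableMul₂ G] [MeasurableInv G]
  {X : Type*} [MeasurableSpace X] [MulAction G X]

/-- The image of the measure `ω (g⁻¹ • x) dm(g)` on `G` under the map `g ↦ g⁻¹ • x`. -/
def orbitMeasure (m : Measure G) (ω : X → ℝ≥0∞) (x : X) : Measure X :=
  (m.withDensity fun g => ω (g⁻¹ • x)).map fun g => g⁻¹ • x

variable {m : Measure G} [SFinite m] {ω : X → ℝ≥0∞}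

lemma measurable_inv_smul (hs : Measurable fun p : G × X => p.1 • p.2) :
    Measurable fun p : G × X => p.1⁻¹ • p.2 :=
  hs.comp (measurable_fst.inv.prodMk measurable_snd)

lemma measurable_inv_smul_const (hs : Measurable fun p : G × X => p.1 • p.2) (x : X) :
    Measurable fun g : G => g⁻¹ • x :=
  (measurable_inv_smul hs).comp (measurable_id.prodMk measurable_const)

lemma measurable_smul_left (hs : Measurable fun p : G × X => p.1 • p.2) (x : X) :
    Measurable fun g : G => g • x :=
  hs.comp (measurable_id.prodMk measurable_const)

lemma measurable_smul_right (hs : Measurable fun p : G × X => p.1 • p.2) (g : G) :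
    Measurable fun x : X => g • x :=
  hs.comp (measurable_const.prodMk measurable_id)

lemma map_inv_smul_eq (hs : Measurable fun p : G × X => p.1 • p.2) (x : X) :
    (m.map fun g : G => g⁻¹ • x) = m.inv.map fun g => g • x := by
  rw [Measure.inv, Measure.map_map (measurable_smul_left hs x) measurable_inv]
  rfl

lemma orbitMeasure_apply (hs : Measurable fun p : G × X => p.1 • p.2) (x : X) {A : Set X}
    (hA : MeasurableSet A) :
    orbitMeasure m ω x A = ∫⁻ g, A.indicator ω ((g : G)⁻¹ • x) ∂m := by
  have h := measurable_inv_smul_const hs x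
  rw [orbitMeasure, Measure.map_apply h hA, withDensity_apply _ (h hA),
    ← lintegral_indicator (h hA)]
  rfl

lemma measurable_orbitMeasure (hs : Measurable fun p : G × X => p.1 • p.2) (hω : Measurable ω) :
    Measurable (orbitMeasure m ω) := by
  refine Measure.measurable_of_measurable_coe _ fun A hA => ?_
  simp_rw [orbitMeasure_apply hs _ hA]
  exact Measurable.lintegral_prod_right'
    (f := fun p : X × G => A.indicator ω (p.2⁻¹ • p.1))
    ((hω.indicator hA).comp ((measurable_inv_smul hs).comp measurable_swap))

/-- Substituting `h * g` for `g` turns `g⁻¹ • h • x` into `g⁻¹ • x`; this is why the orbit is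
parametrized by inverses when `m` is left invariant. -/
lemma orbitMeasure_smul [m.IsMulLeftInvariant] (hs : Measurable fun p : G × X => p.1 • p.2)
    (h : G) (x : X) : orbitMeasure m ω (h • x) = orbitMeasure m ω x := by
  ext A hA
  rw [orbitMeasure_apply hs _ hA, orbitMeasure_apply hs _ hA,
    ← lintegral_mul_left_eq_self _ h]
  simp [mul_smul]

lemma orbitMeasure_ac [m.IsMulLeftInvariant] (hs : Measurable fun p : G × X => p.1 • p.2) (x : X) :
    orbitMeasure m ω x ≪ m.map fun g => g • x := by
  have h1 := map_inv_smul_eq (m := m) hs x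
  refine ((withDensity_absolutelyContinuous _ _).map (measurable_inv_smul_const hs x)).trans ?_
  rw [h1]
  exact (inv_absolutelyContinuous m).map (measurable_smul_left hs x)

/-- A left invariant measure and its image under inversion have the same null sets, and a density
that never vanishes along the orbit keeps the class. -/
lemma ac_orbitMeasure [m.IsMulLeftInvariant] (hs : Measurable fun p : G × X => p.1 • p.2)
    (hω : Measurable ω) (x : X) (hx : ∀ g : G, ω (g • x) ≠ 0) :
    (m.map fun g => g • x) ≪ orbitMeasure m ω x := by
  have h1 := map_inv_smul_eq (m := m) hs x
  have h2 : (m.map fun g => g • x) ≪ m.inv.map fun g => g • x :=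
    (absolutelyContinuous_inv m).map (measurable_smul_left hs x)
  rw [← h1] at h2
  refine h2.trans (Measure.AbsolutelyContinuous.map ?_ (measurable_inv_smul_const hs x))
  exact withDensity_absolutelyContinuous' (hω.comp (measurable_inv_smul_const hs x)).aemeasurable
    (.of_forall fun g => hx g⁻¹)

lemma bind_orbitMeasure_apply (hs : Measurable fun p : G × X => p.1 • p.2) (hω : Measurable ω)
    (μ : Measure X) [SFinite μ] {A : Set X} (hA : MeasurableSet A) :
    μ.bind (orbitMeasure m ω) A = ∫⁻ g, ∫⁻ x, A.indicator ω ((g : G)⁻¹ • x) ∂μ ∂m := by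
  rw [Measure.bind_apply hA (measurable_orbitMeasure hs hω).aemeasurable]
  simp_rw [orbitMeasure_apply hs _ hA]
  rw [lintegral_lintegral_swap]
  exact ((hω.indicator hA).comp ((measurable_inv_smul hs).comp measurable_swap)).aemeasurable

variable [TopologicalSpace G] {μ : Measure X} [SFinite μ]

lemma bind_orbitMeasure_ac (hns : IsNonsingularAction G μ) (hω : Measurable ω) :
    μ.bind (orbitMeasure m ω) ≪ μ := by
  refine Measure.AbsolutelyContinuous.mk fun A hA h0 => ?_
  have hs := hns.measurable_smul
  rw [bind_orbitMeasure_apply hs hω μ hA]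
  have hsm := measurable_smul_right hs
  refine (lintegral_congr fun g => ?_).trans lintegral_zero
  have hg := hsm g⁻¹
  have h1 := hns.quasi_invariant g⁻¹ h0
  rw [Measure.map_apply hg hA] at h1
  refine (lintegral_eq_zero_iff (f := fun x => A.indicator ω (g⁻¹ • x))
    ((hω.indicator hA).comp hg)).2 ?_
  filter_upwards [measure_eq_zero_iff_ae_notMem.1 h1] with x hx
  exact Set.indicator_of_notMem (s := A) (f := ω) hx

/-- By Tonelli, a null set `A` of the averaged measure has, for at least one `g`, a null translate
of its part in `{ω ≠ 0}`; quasi-invariance moves this part back. -/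
lemma ac_bind_orbitMeasure [NeZero m] (hns : IsNonsingularAction G μ) (hω : Measurable ω)
    (h0 : ∀ᵐ x ∂μ, ω x ≠ 0) : μ ≪ μ.bind (orbitMeasure m ω) := by
  refine Measure.AbsolutelyContinuous.mk fun A hA hA0 => ?_
  have hs := hns.measurable_smul
  have hsm := measurable_smul_right hs
  rw [bind_orbitMeasure_apply hs hω μ hA, lintegral_eq_zero_iff] at hA0
  · obtain ⟨g, hg⟩ := hA0.exists
    replace hg := (lintegral_eq_zero_iff (f := fun x => A.indicator ω (g⁻¹ • x))
      ((hω.indicator hA).comp (hsm g⁻¹))).1 hg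
    have hB : MeasurableSet (A ∩ {x | ω x ≠ 0}) :=
      hA.inter (hω (measurableSet_singleton 0).compl)
    have h1 : μ ((fun x => g⁻¹ • x) ⁻¹' (A ∩ {x | ω x ≠ 0})) = 0 := by
      refine measure_eq_zero_iff_ae_notMem.2 ?_
      filter_upwards [hg] with x hx hxA
      exact hxA.2 (by simpa [Set.indicator_of_mem hxA.1] using hx)
    have h2 := hns.quasi_invariant g h1
    rw [Measure.map_apply (hsm g) ((hsm g⁻¹) hB), ← Set.preimage_comp] at h2
    have h3 : ((fun x : X => g⁻¹ • x) ∘ fun x => g • x) = id := by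
      ext x; simp
    rw [h3, Set.preimage_id] at h2
    refine measure_eq_zero_iff_ae_notMem.2 ?_
    filter_upwards [measure_eq_zero_iff_ae_notMem.1 h2, h0] with x hx hx0 hxA
    exact hx ⟨hxA, hx0⟩
  · exact Measurable.lintegral_prod_right'
      (f := fun p : G × X => A.indicator ω (p.1⁻¹ • p.2))
      ((hω.indicator hA).comp (measurable_inv_smul hs))

end OrbitMeasure

/-! ### A Borel invariant separating orbits, and its conditional measures. -/

section Label

variable {G : Type*} [Group G] [TopologicalSpace G] [MeasurableSpace G] [MeasurableMul₂ G]
  [MeasurableInv G]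
  {X : Type*} [MeasurableSpace X] [StandardBorelSpace X] [MulAction G X]

/-- The values of the orbit measure of `x` on a countable generating family. -/
def orbitLabel (m : Measure G) (ω : X → ℝ≥0∞) (x : X) : ℚ → ℝ≥0∞ :=
  fun r => orbitMeasure m ω x (genSet X r)

variable {m : Measure G} [SFinite m] {ω : X → ℝ≥0∞}

lemma measurable_orbitLabel (hs : Measurable fun p : G × X => p.1 • p.2) (hω : Measurable ω) :
    Measurable (orbitLabel m ω) :=
  measurable_pi_lambda _ fun r =>
    (Measure.measurable_coe (measurableSet_genSet r)).comp (measurable_orbitMeasure hs hω)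

lemma orbitLabel_smul [m.IsMulLeftInvariant] (hs : Measurable fun p : G × X => p.1 • p.2)
    (h : G) (x : X) : orbitLabel m ω (h • x) = orbitLabel m ω x := by
  unfold orbitLabel
  rw [orbitMeasure_smul hs]

lemma orbitMeasure_univ (hs : Measurable fun p : G × X => p.1 • p.2) {x : X}
    (hx : ∫⁻ g, ω ((g : G)⁻¹ • x) ∂m = 1) : orbitMeasure m ω x Set.univ = 1 := by
  rw [orbitMeasure_apply hs x .univ]
  simpa using hx

lemma orbitMeasure_eq_of_orbitLabel_eq (hs : Measurable fun p : G × X => p.1 • p.2) {x x' : X}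
    (hx : ∫⁻ g, ω ((g : G)⁻¹ • x) ∂m = 1) (hx' : ∫⁻ g, ω ((g : G)⁻¹ • x') ∂m = 1)
    (h : orbitLabel m ω x = orbitLabel m ω x') : orbitMeasure m ω x = orbitMeasure m ω x' := by
  have : IsFiniteMeasure (orbitMeasure m ω x) := ⟨by simp [orbitMeasure_univ hs hx]⟩
  exact measure_ext_genSet (fun r => congrFun h r)
    (by rw [orbitMeasure_univ hs hx, orbitMeasure_univ hs hx'])

lemma orbitMeasure_orbitLabel_compl [m.IsMulLeftInvariant]
    (hs : Measurable fun p : G × X => p.1 • p.2) (hω : Measurable ω) (x : X) :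
    orbitMeasure m ω x (orbitLabel m ω ⁻¹' {orbitLabel m ω x})ᶜ = 0 := by
  rw [orbitMeasure_apply hs x ((measurable_orbitLabel hs hω) (measurableSet_singleton _)).compl]
  simp [orbitLabel_smul hs]

/-- Two points with the same label lie in the same orbit. -/
lemma mem_orbit_of_orbitLabel_eq [StandardBorelSpace G]
    (hs : Measurable fun p : G × X => p.1 • p.2) {x x' : X}
    (hx : ∫⁻ g, ω ((g : G)⁻¹ • x) ∂m = 1) (hx' : ∫⁻ g, ω ((g : G)⁻¹ • x') ∂m = 1)
    (h : orbitLabel m ω x = orbitLabel m ω x') : x' ∈ MulAction.orbit G x := by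
  by_contra hn
  let _ := upgradeStandardBorel X
  -- Orbits are Borel images of a standard Borel group, hence analytic. Distinct ones are separated
  -- by a Borel set, to which the two supposedly equal orbit measures give mass 1 and 0.
  have han (z : X) : AnalyticSet (MulAction.orbit G z) := by
    have := MeasurableSet.univ.analyticSet_image (measurable_smul_left hs z)
    rwa [Set.image_univ] at this
  have hd : Disjoint (MulAction.orbit G x) (MulAction.orbit G x') := by
    refine (MulAction.orbit.eq_or_disjoint x x').resolve_left fun he => hn ?_
    rw [he]
    exact MulAction.mem_orbit_self x'
  obtain ⟨B, hB, hB', hBm⟩ := (han x).measurablySeparable (han x') hd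
  have h1 : orbitMeasure m ω x B = 1 := by
    rw [orbitMeasure_apply hs x hBm, ← hx]
    exact lintegral_congr fun g => Set.indicator_of_mem (hB ⟨g⁻¹, rfl⟩) _
  have h2 : orbitMeasure m ω x' B = 0 := by
    rw [orbitMeasure_apply hs x' hBm]
    refine (lintegral_congr fun g => ?_).trans lintegral_zero
    exact Set.indicator_of_notMem (fun hg => Set.disjoint_left.1 hB' ⟨g⁻¹, rfl⟩ hg) _
  rw [orbitMeasure_eq_of_orbitLabel_eq hs hx hx' h, h2] at h1
  exact zero_ne_one h1

variable {μ : Measure X} [IsProbabilityMeasure μ]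

/-- Almost every conditional measure over the orbit label is equivalent to an orbit measure. -/
lemma condDistrib_orbitLabel [Nonempty X] [m.IsMulLeftInvariant] [NeZero m]
    (hns : IsNonsingularAction G μ) (hω : Measurable ω)
    (h1 : ∀ x, ω x ≠ 0 → ∫⁻ g, ω ((g : G)⁻¹ • x) ∂m = 1) (h0 : ∀ᵐ x ∂μ, ω x ≠ 0) :
    ∀ᵐ y ∂(μ.map (orbitLabel m ω)),
      condDistrib id (orbitLabel m ω) μ y (orbitLabel m ω ⁻¹' {y})ᶜ = 0 ∧
      ∃ x, ω x ≠ 0 ∧ orbitLabel m ω x = y ∧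
        condDistrib id (orbitLabel m ω) μ y ≪ orbitMeasure m ω x ∧
        orbitMeasure m ω x ≪ condDistrib id (orbitLabel m ω) μ y := by
  have hs := hns.measurable_smul
  set π := orbitLabel m ω with hπdef
  set O := orbitMeasure m ω with hOdef
  have hπ : Measurable π := measurable_orbitLabel hs hω
  have hO : Measurable O := measurable_orbitMeasure hs hω
  set κ := condDistrib id π μ with hκ
  have hκμ : (μ.map π).bind κ = μ := by
    rw [condDistrib_comp_map hπ.aemeasurable aemeasurable_id, Measure.map_id]
  have hfib : ∀ᵐ y ∂(μ.map π), ∀ᵐ x ∂(κ y), π x = y := by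
    refine Measure.ae_ae_of_ae_compProd (p := fun p : (ℚ → ℝ≥0∞) × X => π p.2 = p.1) ?_
    rw [compProd_map_condDistrib aemeasurable_id]
    refine (ae_map_iff (hπ.prodMk measurable_id).aemeasurable ?_).2 (.of_forall fun x => rfl)
    exact measurableSet_eq_fun (hπ.comp measurable_snd) measurable_fst
  have hne : ∀ᵐ y ∂(μ.map π), ∀ᵐ x ∂(κ y), ω x ≠ 0 := by
    refine Measure.ae_ae_of_ae_bind κ.measurable.aemeasurable ?_
    rwa [hκμ]
  -- `N y` averages the orbit measures over the conditional measure on the fibre of `y`. They are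
  -- almost surely all equal there, so the average is any one of them.
  let Ok : Kernel X X := ⟨O, hO⟩
  let N : Kernel (ℚ → ℝ≥0∞) X := Ok ∘ₖ κ
  have hN : ∀ᵐ y ∂(μ.map π), ∀ x, ω x ≠ 0 → π x = y → N y = O x := by
    filter_upwards [hfib, hne] with y hy hy' x hx hxy
    have : ∀ᵐ z ∂(κ y), O z = O x := by
      filter_upwards [hy, hy'] with z hz hz'
      exact orbitMeasure_eq_of_orbitLabel_eq hs (h1 z hz') (h1 x hx) (hz.trans hxy.symm)
    ext A hA
    rw [Kernel.comp_apply' _ _ _ hA]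
    change ∫⁻ z, O z A ∂(κ y) = _
    rw [lintegral_congr_ae (this.mono fun z hz => by rw [hz]), lintegral_const, measure_univ,
      mul_one]
  -- `μ'` has the class of `μ` and disintegrates over the label into the measures `N y`. The density
  -- of `μ` with respect to `μ'` then turns `N y` into the conditional measures of `μ`.
  set μ' := μ.bind O with hμ'
  have hac : μ' ≪ μ := bind_orbitMeasure_ac hns hω
  have hca : μ ≪ μ' := ac_bind_orbitMeasure hns hω h0
  have hμ'1 : IsProbabilityMeasure μ' := ⟨by
    rw [Measure.bind_apply .univ hO.aemeasurable,
      lintegral_congr_ae (h0.mono fun x hx => orbitMeasure_univ hs (h1 x hx))]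
    simp⟩
  have hNμ' : (μ.map π).bind N = μ' := by
    rw [← Measure.comp_assoc, hκμ]
    rfl
  set D := μ.rnDeriv μ' with hD
  have hDm : Measurable D := Measure.measurable_rnDeriv _ _
  have hμD : μ'.withDensity D = μ := Measure.withDensity_rnDeriv_eq _ _ hca
  have hDpos : ∀ᵐ x ∂μ', D x ≠ 0 :=
    hac.ae_le ((Measure.rnDeriv_pos hca).mono fun x hx => hx.ne')
  have hDN : ∀ᵐ y ∂(μ.map π), ∀ᵐ x ∂(N y), D x ≠ 0 := by
    refine Measure.ae_ae_of_ae_bind N.measurable.aemeasurable ?_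
    rwa [hNμ']
  have hNfib : ∀ᵐ y ∂(μ.map π), ∀ᵐ x ∂(N y), π x = y := by
    filter_upwards [hN, hfib, hne] with y hy hy1 hy2
    obtain ⟨x, hx1, hx2⟩ := (hy1.and hy2).exists
    rw [hy x hx2 hx1]
    have := orbitMeasure_orbitLabel_compl (m := m) hs hω x
    rw [← hπdef, ← hOdef, hx1] at this
    exact this
  -- Both sides are tested against Borel sets `B` of labels. Since `N y` lives on the fibre of `y`,
  -- the indicator of `B` at `y` can be replaced by that of `π ⁻¹' B` inside the integral.
  have hset (A : Set X) (hA : MeasurableSet A) :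
      ∀ᵐ y ∂(μ.map π), ((N y).withDensity D) A = κ y A := by
    have hmeas : Measurable fun y => ∫⁻ x in A, D x ∂(N y) := by
      simp_rw [← lintegral_indicator hA]
      exact (hDm.indicator hA).lintegral_kernel
    simp_rw [withDensity_apply _ hA]
    refine ae_eq_of_forall_setLIntegral_eq_of_sigmaFinite hmeas
      (κ.measurable_coe hA) fun B hB _ => ?_
    rw [setLIntegral_map hB (κ.measurable_coe hA) hπ,
      setLIntegral_preimage_condDistrib hπ aemeasurable_id hA hB, Set.preimage_id]
    have h3 : ∀ᵐ y ∂(μ.map π), B.indicator (fun y => ∫⁻ x in A, D x ∂(N y)) y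
        = ∫⁻ x, (π ⁻¹' B ∩ A).indicator D x ∂(N y) := by
      filter_upwards [hNfib] with y hy
      by_cases hyB : y ∈ B
      · rw [Set.indicator_of_mem hyB, ← lintegral_indicator hA]
        refine lintegral_congr_ae (hy.mono fun x hx => ?_)
        have hxB : x ∈ π ⁻¹' B := by rwa [Set.mem_preimage, hx]
        by_cases hxA : x ∈ A
        · rw [Set.indicator_of_mem hxA, Set.indicator_of_mem (Set.mem_inter hxB hxA)]
        · rw [Set.indicator_of_notMem hxA, Set.indicator_of_notMem fun h => hxA h.2]
      · rw [Set.indicator_of_notMem hyB, eq_comm]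
        refine (lintegral_congr_ae (hy.mono fun x hx => ?_)).trans lintegral_zero
        simp [hx, hyB]
    rw [← lintegral_indicator hB, lintegral_congr_ae h3]
    have hm : MeasurableSet (π ⁻¹' B ∩ A) := (hπ hB).inter hA
    rw [← Measure.lintegral_bind N.measurable.aemeasurable (hDm.indicator hm).aemeasurable, hNμ',
      lintegral_indicator hm, ← withDensity_apply _ hm, hμD]
  have hκN : ∀ᵐ y ∂(μ.map π), (N y).withDensity D = κ y := by
    filter_upwards [hset _ .univ, ae_all_iff.2 fun r => hset _ (measurableSet_genSet r)]
      with y hy hy'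
    have : IsFiniteMeasure ((N y).withDensity D) := ⟨by rw [hy]; simp⟩
    exact measure_ext_genSet hy' hy
  filter_upwards [hfib, hne, hN, hDN, hκN] with y hy1 hy2 hy3 hy4 hy5
  obtain ⟨x, hx1, hx2⟩ := (hy1.and hy2).exists
  refine ⟨hy1, x, hx2, hx1, ?_, ?_⟩
  · rw [← hy3 x hx2 hx1, ← hy5]
    exact withDensity_absolutelyContinuous _ _
  · rw [← hy3 x hx2 hx1, ← hy5]
    exact withDensity_absolutelyContinuous' hDm.aemeasurable hy4

end Label

/-! ### Components carried by one orbit, and the dissipativity criterion. -/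

section Transitive

variable {G : Type*} [Group G] [TopologicalSpace G] [IsTopologicalGroup G] [PolishSpace G]
  [MeasurableSpace G] [BorelSpace G]
  {X : Type*} [MeasurableSpace X] [StandardBorelSpace X] [MulAction G X]

/-- A measure in the class of the image of the Haar measure on a Borel orbit with compact
stabilizer gives a nonsingular, ergodic action that is conjugate to `G ↷ G ⧸ K`. -/
lemma coset_action_of_equiv_haar {m : Measure G} [m.IsHaarMeasure]
    (hs : Measurable fun p : G × X => p.1 • p.2) {x : X}
    (hK : IsCompact (MulAction.stabilizer G x : Set G))
    (horb : MeasurableSet (MulAction.orbit G x)) {μ : Measure X}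
    (h1 : μ ≪ m.map fun g => g • x) (h2 : (m.map fun g => g • x) ≪ μ) :
    IsNonsingularAction G μ ∧ IsErgodicAction G μ ∧ IsCompactCosetAction G μ := by
  classical
  have ho := measurable_smul_left hs x
  have hconull : μ (MulAction.orbit G x)ᶜ = 0 := by
    refine h1 ?_
    rw [Measure.map_apply ho horb.compl]
    convert measure_empty (μ := m)
    ext g
    simp
  refine ⟨⟨hs, fun g => ?_⟩, fun A hA hinv => ?_, ?_⟩
  · have hg := measurable_smul_right hs g
    have h3 : ((m.map fun g => g • x).map fun z => g • z) = m.map fun g => g • x := by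
      rw [Measure.map_map hg ho]
      conv_rhs => rw [← map_mul_left_eq_self m g]
      rw [Measure.map_map ho (measurable_const_mul g)]
      congr 1
      ext h
      simp [mul_smul]
    have h4 := h1.map hg
    rw [h3] at h4
    exact h4.trans h2
  · have key (B : Set X) (hB : MeasurableSet B) (hx : x ∉ B)
        (hB' : ∀ g : G, (fun x => g • x) ⁻¹' B = B) : μ B = 0 := by
      refine h1 ?_
      rw [Measure.map_apply ho hB]
      convert measure_empty (μ := m)
      ext g
      have := Set.ext_iff.1 (hB' g) x
      simp only [Set.mem_preimage] at this
      simp [this, hx]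
    by_cases hx : x ∈ A
    · exact .inr (key _ hA.compl (by simpa) fun g => by rw [Set.preimage_compl, hinv])
    · exact .inl (key _ hA hx hinv)
  · refine ⟨MulAction.stabilizer G x, hK, m, inferInstance, ?_⟩
    have hch (z : X) : ∃ g : G, z ∈ MulAction.orbit G x → g • x = z := by
      by_cases hz : z ∈ MulAction.orbit G x
      · obtain ⟨g, hg⟩ := hz
        exact ⟨g, fun _ => hg⟩
      · exact ⟨1, fun h => absurd h hz⟩
    choose c hc using hch
    let φ : X → G ⧸ MulAction.stabilizer G x :=
      fun z => if z ∈ MulAction.orbit G x then (c z : G ⧸ MulAction.stabilizer G x) else (1 : G)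
    have hφ (g : G) : φ (g • x) = (g : G ⧸ MulAction.stabilizer G x) := by
      have hg : g • x ∈ MulAction.orbit G x := ⟨g, rfl⟩
      simp only [φ, hg, if_true]
      rw [QuotientGroup.eq, MulAction.mem_stabilizer_iff, mul_smul, inv_smul_eq_iff, hc _ hg]
    have hmk : Measurable (QuotientGroup.mk : G → G ⧸ MulAction.stabilizer G x) :=
      QuotientGroup.measurable_coe
    have hφm : Measurable φ := by
      intro B hB
      -- The section `c` need not be measurable. Along the orbit map `φ` becomes the quotient map,
      -- and a subset of a Borel orbit is Borel as soon as its preimage under the orbit map is.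
      have h5 : MeasurableSet ((fun g : G => g • x) ⁻¹' (φ ⁻¹' B)) := by
        convert hmk hB using 1
        ext g
        simp [hφ]
      rw [ho.measurableSet_preimage_iff_inter_range] at h5
      · by_cases h1B : ((1 : G) : G ⧸ MulAction.stabilizer G x) ∈ B
        · convert h5.union horb.compl using 1
          ext z
          by_cases hz : z ∈ MulAction.orbit G x
          · have : z ∈ Set.range fun g : G => g • x := hz
            simp [hz, this]
          · simp [φ, hz, h1B]
        · convert h5 using 1
          ext z
          by_cases hz : z ∈ MulAction.orbit G x
          · have : z ∈ Set.range fun g : G => g • x := hz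
            simp [this]
          · have : z ∉ Set.range fun g : G => g • x := hz
            simp only [Set.mem_preimage, Set.mem_inter_iff, this, and_false, iff_false]
            simp [φ, hz, h1B]
      · exact horb
    have hmap : ((m.map fun g => g • x).map φ) = m.map QuotientGroup.mk := by
      rw [Measure.map_map hφm ho]
      congr 1
      ext g
      exact hφ g
    refine ⟨φ, ⟨hφm, ?_, ?_, MulAction.orbit G x, Set.univ, horb, .univ, hconull, by simp,
      fun _ _ => trivial, ?_, ?_⟩, fun g => ?_⟩
    · rw [← hmap]
      exact h1.map hφm
    · rw [← hmap]
      exact h2.map hφm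
    · rintro _ ⟨g, rfl⟩ _ ⟨h, rfl⟩ hgh
      change φ (g • x) = φ (h • x) at hgh
      rw [hφ, hφ, QuotientGroup.eq, MulAction.mem_stabilizer_iff, mul_smul,
        inv_smul_eq_iff] at hgh
      exact hgh.symm
    · intro z _
      obtain ⟨g, rfl⟩ := QuotientGroup.mk_surjective z
      exact ⟨g • x, ⟨g, rfl⟩, hφ g⟩
    · filter_upwards [measure_eq_zero_iff_ae_notMem.1 hconull] with z hz
      obtain ⟨h, rfl⟩ := not_not.1 hz
      change φ (g • h • x) = g • φ (h • x)
      rw [← mul_smul, hφ, hφ]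
      rfl

/-- A nonsingular action admitting an invariant conull Borel set on which some weight has integral
one along orbits, and on which stabilizers are compact, is dissipative up to compact
stabilizers. -/
theorem isDissipative_of_weight {m : Measure G} [m.IsHaarMeasure] [SigmaFinite m]
    {μ : Measure X} [IsProbabilityMeasure μ] (hns : IsNonsingularAction G μ) {ω : X → ℝ≥0∞}
    (hω : Measurable ω) (h1 : ∀ x, ω x ≠ 0 → ∫⁻ g, ω ((g : G)⁻¹ • x) ∂m = 1)
    (h0 : ∀ᵐ x ∂μ, ω x ≠ 0) (hinv : ∀ (g : G) (x : X), ω x ≠ 0 → ω (g • x) ≠ 0)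
    (hK : ∀ x, ω x ≠ 0 → IsCompact (MulAction.stabilizer G x : Set G)) :
    IsDissipativeUpToCompactStabilizers G μ := by
  have hs := hns.measurable_smul
  have hX : Nonempty X := nonempty_of_isProbabilityMeasure μ
  have hπ : Measurable (orbitLabel m ω) := measurable_orbitLabel hs hω
  have key : ∀ᵐ y ∂(μ.map (orbitLabel m ω)),
      condDistrib id (orbitLabel m ω) μ y (orbitLabel m ω ⁻¹' {y})ᶜ = 0 ∧
      IsNonsingularAction G (condDistrib id (orbitLabel m ω) μ y) ∧
      IsErgodicAction G (condDistrib id (orbitLabel m ω) μ y) ∧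
      IsCompactCosetAction G (condDistrib id (orbitLabel m ω) μ y) := by
    filter_upwards [condDistrib_orbitLabel (m := m) hns hω h1 h0]
    rintro y ⟨hy, x, hx, hxy, hac, hca⟩
    refine ⟨hy, ?_⟩
    -- The orbit is a label fibre cut by `{ω ≠ 0}`, which makes it Borel and not merely analytic.
    have horb : MulAction.orbit G x = orbitLabel m ω ⁻¹' {y} ∩ {z | ω z ≠ 0} := by
      ext z
      constructor
      · rintro ⟨g, rfl⟩
        exact ⟨(orbitLabel_smul hs g x).trans hxy, hinv g x hx⟩
      · rintro ⟨hz, hz0⟩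
        exact mem_orbit_of_orbitLabel_eq hs (h1 x hx) (h1 z hz0) (hxy.trans hz.symm)
    refine coset_action_of_equiv_haar (m := m) hs (hK x hx) ?_
      (hac.trans (orbitMeasure_ac hs x))
      ((ac_orbitMeasure hs hω x fun g => hinv g x hx).trans hca)
    rw [horb]
    exact (hπ (measurableSet_singleton y)).inter (hω (measurableSet_singleton 0).compl)
  refine ⟨hns, ℚ → ℝ≥0∞, inferInstance, inferInstance, orbitLabel m ω,
    condDistrib id (orbitLabel m ω) μ, ⟨hπ, fun g x => orbitLabel_smul hs g x, inferInstance, ?_,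
      ?_, ?_, ?_⟩, ?_⟩
  · rw [condDistrib_comp_map hπ.aemeasurable aemeasurable_id, Measure.map_id]
  · exact key.mono fun y hy => hy.1
  · exact key.mono fun y hy => hy.2.1
  · exact key.mono fun y hy => hy.2.2.1
  · exact key.mono fun y hy => hy.2.2.2

end Transitive

/-! ### The automorphism group as a Polish group, and compactness in it. -/

section Automorphisms

variable {V : Type*} {T : SimpleGraph V}

lemma dist_map_le (hc : T.Connected) (g : T ≃g T) (u v : V) : T.dist (g u) (g v) ≤ T.dist u v := by
  obtain ⟨p, hp⟩ := hc.exists_walk_length_eq_dist u v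
  rw [← hp, ← SimpleGraph.Walk.length_map g.toHom p]
  exact SimpleGraph.dist_le _

lemma dist_map (hc : T.Connected) (g : T ≃g T) (u v : V) : T.dist (g u) (g v) = T.dist u v := by
  refine le_antisymm (dist_map_le hc g u v) ?_
  have := dist_map_le hc g⁻¹ (g u) (g v)
  rwa [RelIso.inv_apply_self, RelIso.inv_apply_self] at this

lemma finite_sphere [T.LocallyFinite] (hc : T.Connected) (v : V) (n : ℕ) :
    {u | T.dist v u = n}.Finite := by
  induction n with
  | zero =>
    refine (Set.finite_singleton v).subset fun u hu => ?_
    exact (hc.dist_eq_zero_iff.1 hu).symm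
  | succ n ih =>
    refine (ih.biUnion fun w _ => (T.neighborSet w).toFinite).subset fun u hu => ?_
    obtain ⟨p, hp⟩ := hc.exists_walk_length_eq_dist u v
    have hu' : T.dist u v = n + 1 := by rw [SimpleGraph.dist_comm]; exact hu
    rw [hu'] at hp
    cases p with
    | nil => simp at hp
    | @cons _ w _ h p =>
      refine Set.mem_biUnion (x := w) ?_ h.symm
      have h1 : T.dist w v ≤ n := by
        have := SimpleGraph.dist_le p
        simp at hp
        omega
      have h2 : T.dist u v ≤ T.dist u w + T.dist w v := hc.dist_triangle
      rw [SimpleGraph.dist_eq_one_iff_adj.2 h] at h2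
      change T.dist v w = n
      rw [SimpleGraph.dist_comm]
      omega

lemma countable_of_locallyFinite [T.LocallyFinite] (hc : T.Connected) : Countable V := by
  obtain ⟨v⟩ := hc.nonempty
  rw [← Set.countable_univ_iff]
  refine (Set.countable_iUnion fun n => (finite_sphere hc v n).countable).mono fun u _ => ?_
  exact Set.mem_iUnion.2 ⟨_, rfl⟩

section Discrete

lemma continuous_apply_apply {Z A B : Type*} [TopologicalSpace Z] [TopologicalSpace A]
    [DiscreteTopology A] [TopologicalSpace B] [DiscreteTopology B] {f : Z → A → B} {b : Z → A}
    (hf : ∀ a, Continuous fun z => f z a) (hb : Continuous b) : Continuous fun z => f z (b z) := by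
  rw [continuous_iff_continuousAt]
  intro z
  have h1 : ∀ᶠ y in nhds z, b y = b z := by
    have := hb.tendsto z
    rwa [nhds_discrete A, Filter.tendsto_pure] at this
  have h2 : ∀ᶠ y in nhds z, f y (b z) = f z (b z) := by
    have := (hf (b z)).tendsto z
    rwa [nhds_discrete B, Filter.tendsto_pure] at this
  rw [ContinuousAt, nhds_discrete B, Filter.tendsto_pure]
  filter_upwards [h1, h2] with y hy hy'
  rw [hy, hy']

variable (T) in
lemma continuous_aut_apply [TopologicalSpace V] [DiscreteTopology V] (v : V) :
    Continuous fun g : T ≃g T => g v := by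
  obtain rfl := DiscreteTopology.eq_bot (α := V)
  let _ : TopologicalSpace V := ⊥
  exact (continuous_apply v).comp continuous_induced_dom

lemma continuous_aut_iff [TopologicalSpace V] [DiscreteTopology V] {Z : Type*} [TopologicalSpace Z]
    {f : Z → (T ≃g T)} : Continuous f ↔ ∀ v, Continuous fun z => f z v := by
  obtain rfl := DiscreteTopology.eq_bot (α := V)
  let _ : TopologicalSpace V := ⊥
  rw [continuous_induced_rng, continuous_pi_iff]
  rfl

instance autIsTopologicalGroup : IsTopologicalGroup (T ≃g T) := by
  let _ : TopologicalSpace V := ⊥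
  have : DiscreteTopology V := ⟨rfl⟩
  refine { continuous_mul := ?_, continuous_inv := ?_ }
  · refine continuous_aut_iff.2 fun v => ?_
    exact continuous_apply_apply (f := fun (p : (T ≃g T) × (T ≃g T)) w => p.1 w)
      (fun w => (continuous_aut_apply T w).comp continuous_fst)
      ((continuous_aut_apply T v).comp continuous_snd)
  · refine continuous_aut_iff.2 fun v => continuous_iff_continuousAt.2 fun g => ?_
    -- Any `h` that agrees with `g` at the vertex `g⁻¹ v` satisfies `h⁻¹ v = g⁻¹ v`.
    have := (continuous_aut_apply T (g⁻¹ v)).tendsto g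
    rw [nhds_discrete V, Filter.tendsto_pure] at this
    rw [ContinuousAt, nhds_discrete V, Filter.tendsto_pure]
    filter_upwards [this] with h hh
    rw [RelIso.apply_inv_self] at hh
    conv_lhs => rw [← hh]
    exact RelIso.inv_apply_self h _

variable (T) in
/-- An automorphism, seen as the pair consisting of the underlying map and its inverse. -/
def autPair (g : T ≃g T) : (V → V) × (V → V) := (fun v => g v, fun v => g⁻¹ v)

/-- Pointwise limits of automorphisms may lose surjectivity; recording the inverse as well makes
bijectivity a closed condition. -/
lemma isClosedEmbedding_autPair [TopologicalSpace V] [DiscreteTopology V] :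
    Topology.IsClosedEmbedding (autPair T) := by
  have hcont : Continuous (autPair T) :=
    (continuous_pi fun v => continuous_aut_apply T v).prodMk
      (continuous_pi fun v => (continuous_aut_apply T v).comp continuous_inv)
  refine ⟨⟨⟨le_antisymm (continuous_iff_le_induced.1 hcont) ?_⟩, ?_⟩, ?_⟩
  · obtain rfl := DiscreteTopology.eq_bot (α := V)
    let _ : TopologicalSpace V := ⊥
    exact (induced_mono inf_le_left).trans induced_compose.le
  · intro g h hgh
    ext v
    exact congrFun (congrArg Prod.fst hgh) v
  · have hrange : Set.range (autPair T) =
        (⋂ v, {p : (V → V) × (V → V) | p.1 (p.2 v) = v}) ∩ (⋂ v, {p | p.2 (p.1 v) = v}) ∩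
          ⋂ v, ⋂ w, {p | T.Adj (p.1 v) (p.1 w) ↔ T.Adj v w} := by
      ext p
      simp only [Set.mem_inter_iff, Set.mem_iInter, Set.mem_ofPred_eq]
      constructor
      · rintro ⟨g, rfl⟩
        exact ⟨⟨fun v => RelIso.apply_inv_self g v, fun v => RelIso.inv_apply_self g v⟩,
          fun v w => g.map_adj_iff⟩
      · rintro ⟨⟨h1, h2⟩, h3⟩
        exact ⟨⟨⟨p.1, p.2, h2, h1⟩, h3 _ _⟩, rfl⟩
    have h1 (v : V) : Continuous fun p : (V → V) × (V → V) => p.1 v :=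
      (continuous_apply v).comp continuous_fst
    have h2 (v : V) : Continuous fun p : (V → V) × (V → V) => p.2 v :=
      (continuous_apply v).comp continuous_snd
    rw [hrange]
    refine ((isClosed_iInter fun v => ?_).inter (isClosed_iInter fun v => ?_)).inter
      (isClosed_iInter fun v => isClosed_iInter fun w => ?_)
    · exact isClosed_eq (continuous_apply_apply h1 (h2 v)) continuous_const
    · exact isClosed_eq (continuous_apply_apply h2 (h1 v)) continuous_const
    · exact (isClosed_discrete {z : V × V | T.Adj z.1 z.2 ↔ T.Adj v w}).preimage
        ((h1 v).prodMk (h1 w))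

lemma polishSpace_aut [Countable V] : PolishSpace (T ≃g T) := by
  let _ : TopologicalSpace V := ⊥
  have : DiscreteTopology V := ⟨rfl⟩
  have h1 : PolishSpace V := inferInstance
  have h2 : PolishSpace (V → V) := inferInstance
  exact isClosedEmbedding_autPair.polishSpace

/-- A closed set of automorphisms of a locally finite connected graph is compact if it moves some
vertex to finitely many places only. -/
lemma isCompact_aut_of_finite [T.LocallyFinite] (hc : T.Connected) (ρ : V) {C : Set (T ≃g T)}
    (hC : IsClosed C) (hfin : ((fun g : T ≃g T => g ρ) '' C).Finite) : IsCompact C := by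
  let _ : TopologicalSpace V := ⊥
  have : DiscreteTopology V := ⟨rfl⟩
  set F := (fun g : T ≃g T => g ρ) '' C with hF
  -- Since `g` is an isometry with `g ρ` in the finite set `F`, both `g v` and `g⁻¹ v` are confined
  -- to finite unions of spheres, and Tychonoff applies.
  let K : Set ((V → V) × (V → V)) :=
    (Set.univ.pi fun v => ⋃ w ∈ F, {u | T.dist w u = T.dist ρ v}) ×ˢ
      (Set.univ.pi fun v => ⋃ w ∈ F, {u | T.dist ρ u = T.dist w v})
  have hK : IsCompact K :=
    (isCompact_univ_pi fun v => (hfin.biUnion fun w _ => finite_sphere hc _ _).isCompact).prod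
      (isCompact_univ_pi fun v => (hfin.biUnion fun w _ => finite_sphere hc _ _).isCompact)
  refine (isClosedEmbedding_autPair.isCompact_preimage hK).of_isClosed_subset hC fun g hg => ?_
  have hgF : g ρ ∈ F := ⟨g, hg, rfl⟩
  refine ⟨fun v _ => Set.mem_biUnion hgF (dist_map hc g ρ v), fun v _ => Set.mem_biUnion hgF ?_⟩
  change T.dist ρ (g⁻¹ v) = T.dist (g ρ) v
  rw [← dist_map hc g ρ, RelIso.apply_inv_self]

lemma isOpen_stabilizer_aut (ρ u : V) : IsOpen {g : T ≃g T | g ρ = u} := by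
  let _ : TopologicalSpace V := ⊥
  have : DiscreteTopology V := ⟨rfl⟩
  exact (isOpen_discrete {u}).preimage (continuous_aut_apply T ρ)

lemma measurable_aut_apply [Countable V] (ρ : V) : @Measurable _ _ _ ⊤ fun g : T ≃g T => g ρ := by
  let _ : MeasurableSpace V := ⊤
  exact measurable_to_countable' fun u => (isOpen_stabilizer_aut ρ u).measurableSet

end Discrete

end Automorphisms

/-! ### Compactness in a closed group of automorphisms. -/

section Subgroup

variable {V : Type*} {T : SimpleGraph V} {G : Subgroup (T ≃g T)}

lemma isCompact_subgroup_of_finite [T.LocallyFinite] (hc : T.Connected)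
    (hG : IsClosed (G : Set (T ≃g T))) (ρ : V) {C : Set G} (hC : IsClosed C)
    (hfin : ((fun g : G => (g : T ≃g T) ρ) '' C).Finite) : IsCompact C := by
  have he := hG.isClosedEmbedding_subtypeVal
  rw [he.isEmbedding.isCompact_iff]
  refine isCompact_aut_of_finite hc ρ (he.isClosedMap C hC) ?_
  rwa [Set.image_image]

/-- The stabilizer of a vertex in a closed subgroup, as a compact open set. -/
def vertexStabilizer [T.LocallyFinite] (hc : T.Connected) (hG : IsClosed (G : Set (T ≃g T)))
    (ρ : V) : TopologicalSpace.PositiveCompacts G where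
  carrier := {g | (g : T ≃g T) ρ = ρ}
  isCompact' := by
    refine isCompact_subgroup_of_finite hc hG ρ ?_ ((Set.finite_singleton ρ).subset ?_)
    · rw [← isOpen_compl_iff]
      have : {g : G | (g : T ≃g T) ρ = ρ}ᶜ = ⋃ u ∈ {u | u ≠ ρ}, {g : G | (g : T ≃g T) ρ = u} := by
        ext g
        simp
      rw [this]
      exact isOpen_biUnion fun u _ => (isOpen_stabilizer_aut ρ u).preimage continuous_subtype_val
    · rintro _ ⟨g, hg, rfl⟩
      exact hg
  interior_nonempty' := by
    refine ⟨1, mem_interior.2 ⟨_, subset_rfl, ?_, rfl⟩⟩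
    exact (isOpen_stabilizer_aut ρ ρ).preimage continuous_subtype_val

end Subgroup

/-! ### Infinite products differing in finitely many factors. -/

section InfiniteProduct

variable {ι : Type*} {Ω : ι → Type*} [∀ i, MeasurableSpace (Ω i)] (P P' : ∀ i, Measure (Ω i))
  [∀ i, IsProbabilityMeasure (P i)] [∀ i, IsProbabilityMeasure (P' i)]

lemma lintegral_prod_infinitePi (s : Finset ι) {f : ∀ i, Ω i → ℝ≥0∞} (hf : ∀ i, Measurable (f i)) :
    ∫⁻ x, ∏ i ∈ s, f i (x i) ∂(Measure.infinitePi P) = ∏ i ∈ s, ∫⁻ y, f i y ∂(P i) := by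
  rw [lintegral_prod_eq_prod_lintegral_of_indepFun s
    (fun i (x : ∀ i, Ω i) => f i (x i))
    (iIndepFun_infinitePi hf) fun i => (hf i).comp (measurable_pi_apply i)]
  refine Finset.prod_congr rfl fun i _ => ?_
  rw [← Measure.infinitePi_map_eval P i, lintegral_map (hf i) (measurable_pi_apply i)]

/-- Changing finitely many factors of a product measure within their measure class does not change
the class of the product. -/
lemma infinitePi_ac_of_finite (F : Finset ι) (hF : ∀ i ∉ F, P' i = P i) (hac : ∀ i, P' i ≪ P i) :
    Measure.infinitePi P' ≪ Measure.infinitePi P := by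
  classical
  have hd (i : ι) : (P i).withDensity ((P' i).rnDeriv (P i)) = P' i :=
    Measure.withDensity_rnDeriv_eq _ _ (hac i)
  have hm (i : ι) : Measurable ((P' i).rnDeriv (P i)) := Measure.measurable_rnDeriv _ _
  have key : (Measure.infinitePi P).withDensity (fun x => ∏ i ∈ F, (P' i).rnDeriv (P i) (x i)) =
      Measure.infinitePi P' := by
    refine Measure.eq_infinitePi P' fun s t ht => ?_
    have hst : MeasurableSet (Set.pi (s : Set ι) t) :=
      MeasurableSet.pi s.countable_toSet fun i _ => ht i
    rw [withDensity_apply _ hst, ← lintegral_indicator hst]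
    -- On a box over `s` the density times the indicator is a product of one-coordinate functions
    -- indexed by `s ∪ F`.
    let h (i : ι) (y : Ω i) : ℝ≥0∞ :=
      (if i ∈ s then (t i).indicator 1 y else 1) * if i ∈ F then (P' i).rnDeriv (P i) y else 1
    have hh (i : ι) : Measurable (h i) := by
      refine Measurable.mul ?_ ?_
      · split_ifs
        · exact measurable_one.indicator (ht i)
        · exact measurable_const
      · split_ifs
        · exact hm i
        · exact measurable_const
    have h1 (x : ∀ i, Ω i) : (Set.pi (s : Set ι) t).indicator
        (fun x => ∏ i ∈ F, (P' i).rnDeriv (P i) (x i)) x = ∏ i ∈ s ∪ F, h i (x i) := by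
      rw [Finset.prod_mul_distrib, Finset.prod_ite_mem, Finset.prod_ite_mem,
        Finset.union_inter_cancel_left, Finset.union_inter_cancel_right]
      by_cases hx : x ∈ Set.pi (s : Set ι) t
      · rw [Set.indicator_of_mem hx]
        have : ∏ i ∈ s, (t i).indicator (1 : Ω i → ℝ≥0∞) (x i) = 1 :=
          Finset.prod_eq_one fun i hi => by rw [Set.indicator_of_mem (hx i hi)]; rfl
        rw [this, one_mul]
      · rw [Set.indicator_of_notMem hx]
        obtain ⟨i, hi, hxi⟩ : ∃ i ∈ s, x i ∉ t i := by simpa [Set.mem_pi] using hx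
        rw [Finset.prod_eq_zero hi (Set.indicator_of_notMem hxi _), zero_mul]
    rw [lintegral_congr h1, lintegral_prod_infinitePi P _ hh,
      ← Finset.prod_subset (Finset.subset_union_left (s₁ := s) (s₂ := F))]
    · refine Finset.prod_congr rfl fun i hi => ?_
      have h2 : ∀ y, h i y = (t i).indicator
          (fun y => if i ∈ F then (P' i).rnDeriv (P i) y else 1) y := by
        intro y
        by_cases hy : y ∈ t i <;> simp [h, hi, hy]
      rw [lintegral_congr h2, lintegral_indicator (ht i)]
      by_cases hiF : i ∈ F
      · simp only [hiF, if_true]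
        rw [← withDensity_apply _ (ht i), hd]
      · simp [hiF, hF i hiF]
    -- An index of `F` outside `s` integrates its density over the whole factor and contributes 1.
    · intro i hi his
      have hiF : i ∈ F := (Finset.mem_union.1 hi).resolve_left his
      have h2 : ∀ y, h i y = (P' i).rnDeriv (P i) y := fun y => by simp [h, his, hiF]
      rw [lintegral_congr h2, ← setLIntegral_univ, ← withDensity_apply _ .univ, hd, measure_univ]
  rw [← key]
  exact withDensity_absolutelyContinuous _ _

end InfiniteProduct

/-! ### The generalized Bernoulli action is nonsingular. -/

section Action

variable {V : Type*} {T : SimpleGraph V}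

lemma eventually_smul_dart_eq (g : T ≃g T) (e : T.Dart) : ∀ᶠ h in nhds g, h • e = g • e := by
  filter_upwards [(isOpen_stabilizer_aut e.fst (g e.fst)).mem_nhds rfl,
    (isOpen_stabilizer_aut e.snd (g e.snd)).mem_nhds rfl] with h h1 h2
  exact SimpleGraph.Dart.ext _ _ (Prod.ext h1 h2)

lemma isOpen_inv_smul_dart (e : T.Dart) (s : Set T.Dart) :
    IsOpen {g : T ≃g T | g⁻¹ • e ∈ s} := by
  have h1 : IsOpen {g : T ≃g T | g • e ∈ s} := by
    rw [isOpen_iff_mem_nhds]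
    intro g hg
    filter_upwards [eventually_smul_dart_eq g e] with h hh
    rwa [hh]
  exact h1.preimage continuous_inv

variable {G : Subgroup (T ≃g T)} {X₀ : Type*}

lemma isClosed_stabilizer_config (x : T.Dart → X₀) :
    IsClosed (MulAction.stabilizer G x : Set G) := by
  have : (MulAction.stabilizer G x : Set G) =
      ⋂ e, {g : G | (g : T ≃g T)⁻¹ • e ∈ {d | x d = x e}ᶜ}ᶜ := by
    ext g
    simp only [SetLike.mem_coe, MulAction.mem_stabilizer_iff, Set.mem_iInter]
    constructor
    · intro h e
      exact not_not.2 (congrFun h e)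
    · intro h
      funext e
      exact not_not.1 (h e)
  rw [this]
  exact isClosed_iInter fun e =>
    ((isOpen_inv_smul_dart e {d | x d = x e}ᶜ).preimage continuous_subtype_val).isClosed_compl

variable [MeasurableSpace X₀]

lemma measurable_smul_config [Countable V] :
    Measurable fun p : G × (T.Dart → X₀) => p.1 • p.2 := by
  refine measurable_pi_iff.2 fun e => ?_
  let _ : MeasurableSpace T.Dart := ⊤
  have : Countable T.Dart :=
    (SimpleGraph.Dart.toProd_injective (G := T)).countable
  have h1 : Measurable fun p : T.Dart × (T.Dart → X₀) => p.2 p.1 :=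
    measurable_from_prod_countable_right fun d => measurable_pi_apply d
  have h2 : Measurable fun g : G => (g : T ≃g T)⁻¹ • e :=
    measurable_to_countable' fun d =>
      ((isOpen_inv_smul_dart e {d}).preimage continuous_subtype_val).measurableSet
  exact h1.comp ((h2.comp measurable_fst).prodMk measurable_snd)

/-- In a tree, the orientations of an edge relative to two adjacent vertices only differ if the edge
joins these two vertices. -/
lemma orientation_eq_of_adj (hT : T.IsTree) {a b v w : V} (hab : T.Adj a b) (hvw : T.Adj v w)
    (h1 : T.dist a w < T.dist a v) (h2 : T.dist b v < T.dist b w) : a = w ∧ b = v := by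
  have ha : T.dist a v = T.dist a w + 1 := by
    have := hvw.diff_dist_adj (u := a)
    omega
  have hb : T.dist b w = T.dist b v + 1 := by
    have := hvw.diff_dist_adj (u := b)
    omega
  have h3 : T.dist b w ≤ T.dist a w + 1 := by
    have := hT.connected.dist_triangle (u := b) (v := a) (w := w)
    rw [SimpleGraph.dist_eq_one_iff_adj.2 hab.symm] at this
    omega
  have h4 : T.dist a v ≤ T.dist b v + 1 := by
    have := hT.connected.dist_triangle (u := a) (v := b) (w := v)
    rw [SimpleGraph.dist_eq_one_iff_adj.2 hab] at this
    omega
  obtain ⟨p, hp⟩ := hT.connected.exists_walk_length_eq_dist b v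
  obtain ⟨r, hr⟩ := hT.connected.exists_walk_length_eq_dist a w
  have hp1 : (p.concat hvw).IsPath := by
    refine SimpleGraph.Walk.isPath_of_length_eq_dist _ ?_
    rw [SimpleGraph.Walk.length_concat]
    omega
  have hr1 : (SimpleGraph.Walk.cons hab.symm r).IsPath := by
    refine SimpleGraph.Walk.isPath_of_length_eq_dist _ ?_
    rw [SimpleGraph.Walk.length_cons]
    omega
  have heq : p.concat hvw = SimpleGraph.Walk.cons hab.symm r :=
    congrArg Subtype.val ((hT.isAcyclic.subsingleton_path _ _).elim ⟨_, hp1⟩ ⟨_, hr1⟩)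
  cases p with
  | nil =>
    rw [SimpleGraph.Walk.concat_nil] at heq
    simp only [SimpleGraph.Walk.cons.injEq] at heq
    exact ⟨heq.1.symm, rfl⟩
  | @cons _ c _ h p =>
    rw [SimpleGraph.Walk.concat_cons] at heq
    simp only [SimpleGraph.Walk.cons.injEq] at heq
    obtain ⟨rfl, -⟩ := heq
    have := SimpleGraph.dist_le p
    rw [SimpleGraph.Walk.length_cons] at hp
    omega

/-- Moving the root across one edge reverses only the two darts of that edge; the claim follows by
induction along a walk from `a` to `b`. -/
lemma finite_orientation_ne (hT : T.IsTree) (a b : V) :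
    {e : T.Dart | ¬(T.dist a e.snd < T.dist a e.fst ↔ T.dist b e.snd < T.dist b e.fst)}.Finite := by
  obtain ⟨p⟩ := hT.connected a b
  induction p with
  | nil => simp
  | @cons a c b h p ih =>
    refine (ih.union (Set.toFinite {⟨(a, c), h⟩, ⟨(c, a), h.symm⟩})).subset fun e he => ?_
    by_contra hn
    simp only [Set.mem_union, Set.mem_ofPred_eq, not_or, not_not, Set.mem_insert_iff,
      Set.mem_singleton_iff] at hn he
    rw [← hn.1] at he
    have h5 := hT.dist_ne_of_adj a e.adj
    have h6 := hT.dist_ne_of_adj c e.adj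
    rcases lt_or_gt_of_ne h5 with h7 | h7
    · have h8 : T.dist c e.snd < T.dist c e.fst := by
        by_contra h9
        exact he (iff_of_false (by omega) h9)
      obtain ⟨h9, h10⟩ := orientation_eq_of_adj hT h e.adj.symm h7 h8
      exact hn.2.1 (SimpleGraph.Dart.ext _ _ (Prod.ext h9.symm h10.symm))
    · have h8 : T.dist c e.fst < T.dist c e.snd := by
        by_contra h9
        exact he (iff_of_true (by omega) (by omega))
      obtain ⟨h9, h10⟩ := orientation_eq_of_adj hT h e.adj h7 h8
      exact hn.2.2 (SimpleGraph.Dart.ext _ _ (Prod.ext h10.symm h9.symm))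

/-- The translate by `g` is the Bernoulli measure with root `g ρ`, which differs from the original
in finitely many mutually equivalent factors. -/
lemma isNonsingularAction_config [Countable V] (hT : T.IsTree) (ρ : V) (μ₀ μ₁ : Measure X₀)
    [IsProbabilityMeasure μ₀] [IsProbabilityMeasure μ₁] (h01 : μ₀ ≪ μ₁) (h10 : μ₁ ≪ μ₀) :
    IsNonsingularAction G (bernoulliMeasure T ρ μ₀ μ₁) := by
  refine ⟨measurable_smul_config, fun g => ?_⟩
  have h1 : (bernoulliMeasure T ρ μ₀ μ₁).map (fun x => g • x) =
      Measure.infinitePi fun e : T.Dart => edgeMeasure ρ μ₀ μ₁ ((g : T ≃g T)⁻¹ • e) :=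
    Measure.map_infinitePi_infinitePi_of_inj (MulAction.injective _)
  have hac (e e' : T.Dart) : edgeMeasure ρ μ₀ μ₁ e ≪ edgeMeasure ρ μ₀ μ₁ e' := by
    unfold edgeMeasure
    split_ifs <;> first | exact h01 | exact h10 | exact Measure.AbsolutelyContinuous.rfl
  rw [h1]
  refine infinitePi_ac_of_finite _ _ (finite_orientation_ne hT ((g : T ≃g T) ρ) ρ).toFinset
    (fun e he => ?_) fun e => hac _ _
  have he' : T.dist ((g : T ≃g T) ρ) e.snd < T.dist ((g : T ≃g T) ρ) e.fst ↔
      T.dist ρ e.snd < T.dist ρ e.fst := by simpa using he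
  have h2 (v : V) : T.dist ρ ((g : T ≃g T)⁻¹ v) = T.dist ((g : T ≃g T) ρ) v := by
    rw [← dist_map hT.connected (g : T ≃g T) ρ, RelIso.apply_inv_self]
  unfold edgeMeasure
  change (if T.dist ρ ((g : T ≃g T)⁻¹ e.snd) < T.dist ρ ((g : T ≃g T)⁻¹ e.fst) then μ₀ else μ₁) = _
  rw [h2, h2]
  simp only [he']

end Action

/-! ### The Radon–Nikodym cocycle along geodesics. -/

section Weight

variable {V : Type*} {T : SimpleGraph V} {X₀ : Type*}

/-- The factor contributed by a step of a walk: the quotient of the values of `f` at the two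
orientations of the edge. -/
def stepRatio (f : X₀ → ℝ≥0) (x : T.Dart → X₀) {u v : V} (h : T.Adj u v) : ℝ≥0 :=
  f (x ⟨(v, u), h.symm⟩) / f (x ⟨(u, v), h⟩)

/-- The product of the step factors along a walk. -/
def walkWeight (f : X₀ → ℝ≥0) (x : T.Dart → X₀) : {u v : V} → T.Walk u v → ℝ≥0
  | _, _, .nil => 1
  | _, _, .cons h p => stepRatio f x h * walkWeight f x p

variable {f : X₀ → ℝ≥0} {x : T.Dart → X₀}

lemma stepRatio_mul_symm (hf : ∀ y, f y ≠ 0) {u v : V} (h : T.Adj u v) :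
    stepRatio f x h * stepRatio f x h.symm = 1 := by
  have h1 := hf (x ⟨(v, u), h.symm⟩)
  have h2 := hf (x ⟨(u, v), h⟩)
  unfold stepRatio
  field_simp

lemma stepRatio_ne_zero (hf : ∀ y, f y ≠ 0) {u v : V} (h : T.Adj u v) : stepRatio f x h ≠ 0 :=
  div_ne_zero (hf _) (hf _)

lemma walkWeight_append {u v w : V} (p : T.Walk u v) (q : T.Walk v w) :
    walkWeight f x (p.append q) = walkWeight f x p * walkWeight f x q := by
  induction p with
  | nil => simp [walkWeight]
  | cons h p ih => simp [walkWeight, ih, mul_assoc]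

/-- In an acyclic graph, erasing loops removes only backtracking, and crossing an edge in both
directions contributes the factor 1. Hence weights depend only on endpoints and multiply. -/
lemma walkWeight_bypass [DecidableEq V] (hT : T.IsAcyclic) (hf : ∀ y, f y ≠ 0) {u v : V}
    (p : T.Walk u v) : walkWeight f x p.bypass = walkWeight f x p := by
  induction p with
  | nil => rfl
  | @cons u w v h p ih =>
    rw [SimpleGraph.Walk.bypass]
    split_ifs with hs
    · have h1 : (p.bypass.takeUntil u hs).IsPath := p.bypass_isPath.takeUntil hs
      have h2 : (SimpleGraph.Walk.cons h.symm SimpleGraph.Walk.nil).IsPath := by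
        simpa using h.ne'
      have h3 : p.bypass.takeUntil u hs = .cons h.symm .nil :=
        congrArg Subtype.val ((hT.subsingleton_path _ _).elim ⟨_, h1⟩ ⟨_, h2⟩)
      have h4 := walkWeight_append (f := f) (x := x) (p.bypass.takeUntil u hs)
        (p.bypass.dropUntil u hs)
      rw [SimpleGraph.Walk.take_spec, h3, ih] at h4
      simp only [walkWeight, mul_one] at h4 ⊢
      rw [h4, ← mul_assoc, stepRatio_mul_symm hf, one_mul]
    · simp only [walkWeight, ih]

lemma walkWeight_eq (hT : T.IsAcyclic) (hf : ∀ y, f y ≠ 0) {u v : V} (p q : T.Walk u v) :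
    walkWeight f x p = walkWeight f x q := by
  classical
  rw [← walkWeight_bypass hT hf p, ← walkWeight_bypass hT hf q]
  congr 1
  exact congrArg Subtype.val
    ((hT.subsingleton_path _ _).elim ⟨_, p.bypass_isPath⟩ ⟨_, q.bypass_isPath⟩)

lemma walkWeight_ne_zero (hf : ∀ y, f y ≠ 0) {u v : V} (p : T.Walk u v) :
    walkWeight f x p ≠ 0 := by
  induction p with
  | nil => simp [walkWeight]
  | cons h p ih => exact mul_ne_zero (stepRatio_ne_zero hf h) ih

lemma walkWeight_map (g : T ≃g T) {u v : V} (p : T.Walk u v) :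
    walkWeight f (g • x) (p.map g.toHom) = walkWeight f x p := by
  induction p with
  | nil => rfl
  | @cons u w v h p ih =>
    rw [SimpleGraph.Walk.map_cons, walkWeight, ih, walkWeight]
    congr 1
    have h1 (a b : V) (hab : T.Adj a b) (hab' : T.Adj (g a) (g b)) :
        (g • x) ⟨(g a, g b), hab'⟩ = x ⟨(a, b), hab⟩ := by
      change x (g⁻¹ • _) = _
      congr 1
      exact SimpleGraph.Dart.ext _ _
        (Prod.ext (RelIso.inv_apply_self g a) (RelIso.inv_apply_self g b))
    unfold stepRatio
    congr 2
    · exact h1 w u h.symm _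
    · exact h1 u w h _

lemma measurable_walkWeight [MeasurableSpace X₀] (hf : Measurable f) {u v : V} (p : T.Walk u v) :
    Measurable fun x : T.Dart → X₀ => walkWeight f x p := by
  induction p with
  | nil => exact measurable_const
  | cons h p ih =>
    exact ((hf.comp (measurable_pi_apply _)).div (hf.comp (measurable_pi_apply _))).mul ih

/-- The weight of `v` relative to `u`: the product of the step factors along the geodesic. -/
def weight (hc : T.Connected) (f : X₀ → ℝ≥0) (x : T.Dart → X₀) (u v : V) : ℝ≥0 :=
  walkWeight f x (hc u v).some

lemma weight_eq (hT : T.IsTree) (hf : ∀ y, f y ≠ 0) {u v : V} (p : T.Walk u v) :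
    weight hT.connected f x u v = walkWeight f x p :=
  walkWeight_eq hT.isAcyclic hf _ _

lemma weight_self (hT : T.IsTree) (hf : ∀ y, f y ≠ 0) (u : V) :
    weight hT.connected f x u u = 1 :=
  weight_eq hT hf .nil

lemma weight_mul (hT : T.IsTree) (hf : ∀ y, f y ≠ 0) (u v w : V) :
    weight hT.connected f x u v * weight hT.connected f x v w = weight hT.connected f x u w := by
  rw [weight_eq hT hf ((hT.connected u v).some.append (hT.connected v w).some), walkWeight_append]
  rfl

lemma weight_ne_zero (hc : T.Connected) (hf : ∀ y, f y ≠ 0) (u v : V) : weight hc f x u v ≠ 0 :=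
  walkWeight_ne_zero hf _

lemma weight_smul (hT : T.IsTree) (hf : ∀ y, f y ≠ 0) (g : T ≃g T) (u v : V) :
    weight hT.connected f (g • x) (g u) (g v) = weight hT.connected f x u v := by
  exact (weight_eq hT hf ((hT.connected u v).some.map g.toHom)).trans (walkWeight_map g _)

lemma measurable_weight [MeasurableSpace X₀] (hc : T.Connected) (hf : Measurable f) (u v : V) :
    Measurable fun x : T.Dart → X₀ => weight hc f x u v :=
  measurable_walkWeight hf _

end Weight

/-! ### From summable weights to dissipativity. -/

section WeightSum

variable {V : Type*} {T : SimpleGraph V} {X₀ : Type*} (G : Subgroup (T ≃g T))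

/-- The sum of the weights over the orbit of the root. -/
def weightSum (hc : T.Connected) (f : X₀ → ℝ≥0) (ρ : V) (x : T.Dart → X₀) : ℝ≥0∞ :=
  ∑' w : MulAction.orbit G ρ, (weight hc f x ρ w : ℝ≥0∞)

variable {G} {f : X₀ → ℝ≥0} {x : T.Dart → X₀}

lemma one_le_weightSum (hT : T.IsTree) (hf : ∀ y, f y ≠ 0) (ρ : V) :
    1 ≤ weightSum G hT.connected f ρ x := by
  refine le_trans ?_ (ENNReal.le_tsum ⟨ρ, MulAction.mem_orbit_self ρ⟩)
  rw [weight_self hT hf]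
  rfl

/-- Reindex the orbit by `g`, route every weight through `g ρ` by the cocycle identity, and use
equivariance for the second factor. -/
lemma weightSum_eq_mul (hT : T.IsTree) (hf : ∀ y, f y ≠ 0) (ρ : V) (g : G) :
    weightSum G hT.connected f ρ x =
      weight hT.connected f x ρ ((g : T ≃g T) ρ) * weightSum G hT.connected f ρ (g⁻¹ • x) := by
  unfold weightSum
  rw [← ENNReal.tsum_mul_left, ← (MulAction.toPerm g : Equiv.Perm (MulAction.orbit G ρ)).tsum_eq]
  refine tsum_congr fun w => ?_
  have h1 : (((MulAction.toPerm g : Equiv.Perm (MulAction.orbit G ρ)) w : MulAction.orbit G ρ) : V)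
      = (g : T ≃g T) w := rfl
  have h2 := weight_smul (x := g⁻¹ • x) hT hf (g : T ≃g T) ρ w
  have h3 : (g : T ≃g T) • g⁻¹ • x = x := smul_inv_smul g x
  rw [h3] at h2
  rw [h1, ← h2, ← weight_mul hT hf ρ ((g : T ≃g T) ρ), ENNReal.coe_mul]

lemma measurable_weightSum [Countable V] [MeasurableSpace X₀] (hc : T.Connected) (hf : Measurable f)
    (ρ : V) : Measurable (weightSum G hc f ρ) :=
  Measurable.tsum fun w => (measurable_weight hc hf ρ w).coe_nnreal_ennreal

/-- The integrand depends only on `g ρ`, and the fibres of `g ↦ g ρ` are left cosets of the vertex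
stabilizer, each of mass 1. -/
lemma lintegral_weight [Countable V] (hc : T.Connected) (ρ : V) {m : Measure G}
    [m.IsMulLeftInvariant] (hm : m {g | (g : T ≃g T) ρ = ρ} = 1) :
    ∫⁻ g, (weight hc f x ρ ((g : T ≃g T) ρ) : ℝ≥0∞) ∂m = weightSum G hc f ρ x := by
  let _ : MeasurableSpace V := ⊤
  have hev : Measurable fun g : G => (g : T ≃g T) ρ :=
    (measurable_aut_apply ρ).comp measurable_subtype_coe
  rw [← lintegral_map (f := fun v => (weight hc f x ρ v : ℝ≥0∞)) (measurable_of_countable _) hev,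
    lintegral_countable', weightSum, tsum_subtype (MulAction.orbit G ρ)
      fun v => (weight hc f x ρ v : ℝ≥0∞)]
  refine tsum_congr fun v => ?_
  rw [Measure.map_apply hev (measurableSet_singleton v)]
  by_cases hv : v ∈ MulAction.orbit G ρ
  · obtain ⟨h, rfl⟩ := hv
    rw [Set.indicator_of_mem (MulAction.mem_orbit ρ h)]
    have : (fun g : G => (g : T ≃g T) ρ) ⁻¹' {h • ρ} =
        (fun g => h⁻¹ * g) ⁻¹' {g : G | (g : T ≃g T) ρ = ρ} := by
      ext g
      change (g • ρ = h • ρ) ↔ (h⁻¹ * g) • ρ = ρ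
      rw [mul_smul, inv_smul_eq_iff]
    rw [this, measure_preimage_mul, hm, mul_one]
  · rw [Set.indicator_of_notMem hv]
    have : (fun g : G => (g : T ≃g T) ρ) ⁻¹' {v} = ∅ :=
      Set.eq_empty_of_forall_notMem fun g hg => hv ⟨g, hg⟩
    rw [this, measure_empty, mul_zero]

/-- If `g` fixes `x`, the transformation rule reads S = weight · S with 0 < S < ∞, so the weight at
`g ρ` is 1. A summable family has finitely many terms at least 1, so the stabilizer moves `ρ` to
finitely many places. -/
lemma isCompact_stabilizer_of_weightSum [T.LocallyFinite] (hT : T.IsTree)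
    (hG : IsClosed (G : Set (T ≃g T))) (hf : ∀ y, f y ≠ 0) (ρ : V)
    (hx : weightSum G hT.connected f ρ x ≠ ∞) :
    IsCompact (MulAction.stabilizer G x : Set G) := by
  refine isCompact_subgroup_of_finite hT.connected hG ρ (isClosed_stabilizer_config x) ?_
  have hfin := ENNReal.finite_const_le_of_tsum_ne_top hx one_ne_zero
  refine (hfin.image Subtype.val).subset ?_
  rintro _ ⟨g, hg, rfl⟩
  refine ⟨⟨(g : T ≃g T) ρ, ⟨g, rfl⟩⟩, ?_, rfl⟩
  have h1 := weightSum_eq_mul (G := G) (x := x) hT hf ρ g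
  have h2 : g⁻¹ • x = x := by
    rw [inv_smul_eq_iff]
    exact (MulAction.mem_stabilizer_iff.1 hg).symm
  rw [h2] at h1
  have h3 : weightSum G hT.connected f ρ x ≠ 0 :=
    (zero_lt_one.trans_le (one_le_weightSum hT hf ρ)).ne'
  have h4 := (ENNReal.mul_left_inj h3 hx).1 ((one_mul _).trans h1)
  exact h4.le

/-- If the weights are almost surely summable over the orbit of the root, then the generalized
Bernoulli action is dissipative up to compact stabilizers. -/
theorem isDissipative_of_summable [T.LocallyFinite] (hT : T.IsTree)
    (hG : IsClosed (G : Set (T ≃g T))) [MeasurableSpace X₀] [StandardBorelSpace X₀] (ρ : V)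
    (μ₀ μ₁ : Measure X₀) [IsProbabilityMeasure μ₀] [IsProbabilityMeasure μ₁] (h01 : μ₀ ≪ μ₁)
    (h10 : μ₁ ≪ μ₀) (hf : Measurable f) (hf0 : ∀ y, f y ≠ 0)
    (hsum : ∀ᵐ x ∂(bernoulliMeasure T ρ μ₀ μ₁), ∑' v, (weight hT.connected f x ρ v : ℝ≥0∞) ≠ ∞) :
    IsDissipativeUpToCompactStabilizers G (bernoulliMeasure T ρ μ₀ μ₁) := by
  have hV : Countable V := countable_of_locallyFinite hT.connected
  have hD : Countable T.Dart := (SimpleGraph.Dart.toProd_injective (G := T)).countable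
  have hP : PolishSpace (T ≃g T) := polishSpace_aut
  have hPG : PolishSpace G := hG.polishSpace
  have : IsProbabilityMeasure (bernoulliMeasure T ρ μ₀ μ₁) := by
    unfold bernoulliMeasure
    infer_instance
  let K₀ := vertexStabilizer hT.connected hG ρ
  have hm : Measure.haarMeasure K₀ {g : G | (g : T ≃g T) ρ = ρ} = 1 := Measure.haarMeasure_self
  have hS := measurable_weightSum (G := G) hT.connected hf ρ
  have htop (g : G) (x : T.Dart → X₀) (hx : weightSum G hT.connected f ρ x ≠ ∞) :
      weightSum G hT.connected f ρ (g⁻¹ • x) ≠ ∞ := by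
    intro h
    have h1 := weightSum_eq_mul (x := x) hT hf0 ρ g
    rw [h, ENNReal.mul_top (by simpa using weight_ne_zero hT.connected hf0 _ _)] at h1
    exact hx h1
  -- In `ℝ≥0∞` the inverse of the sum vanishes exactly where the sum diverges, so `{ω ≠ 0}` is the
  -- invariant set of convergence.
  refine isDissipative_of_weight (m := Measure.haarMeasure K₀)
    (ω := fun x => (weightSum G hT.connected f ρ x)⁻¹)
    (isNonsingularAction_config hT ρ μ₀ μ₁ h01 h10) hS.inv (fun x hx => ?_) ?_ (fun g x hx => ?_)
    fun x hx => ?_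
  · have hx' : weightSum G hT.connected f ρ x ≠ ∞ := by simpa using hx
    have hx0 : weightSum G hT.connected f ρ x ≠ 0 :=
      (zero_lt_one.trans_le (one_le_weightSum hT hf0 ρ)).ne'
    have h1 (g : G) : (weightSum G hT.connected f ρ (g⁻¹ • x))⁻¹ =
        weight hT.connected f x ρ ((g : T ≃g T) ρ) * (weightSum G hT.connected f ρ x)⁻¹ := by
      have hw : (weight hT.connected f x ρ ((g : T ≃g T) ρ) : ℝ≥0∞) ≠ 0 := by
        simpa using weight_ne_zero hT.connected hf0 _ _
      rw [weightSum_eq_mul (x := x) hT hf0 ρ g, ENNReal.mul_inv (.inl hw) (.inl ENNReal.coe_ne_top),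
        ← mul_assoc, ENNReal.mul_inv_cancel hw ENNReal.coe_ne_top, one_mul]
    simp_rw [h1]
    rw [lintegral_mul_const' _ _ (by simpa using hx0), lintegral_weight _ _ hm,
      ENNReal.mul_inv_cancel hx0 hx']
  · filter_upwards [hsum] with x hx
    refine ENNReal.inv_ne_zero.2 (ne_top_of_le_ne_top hx ?_)
    exact ENNReal.tsum_comp_le_tsum_of_injective Subtype.val_injective _
  · have := htop g⁻¹ x (ENNReal.inv_ne_zero.1 hx)
    rw [inv_inv] at this
    exact ENNReal.inv_ne_zero.2 this
  · exact isCompact_stabilizer_of_weightSum hT hG hf0 ρ (ENNReal.inv_ne_zero.1 hx)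

end WeightSum

/-! ### A critical multiplicative chain killed above a level. -/

section KilledChain

/-- The value `z`, replaced by `0` when it exceeds the level `L`. -/
def kill (L z : ℝ≥0) : ℝ≥0 := if z ≤ L then z else 0

/-- One step of the multiplicative chain with factor `√y`, killed above the level `L`. -/
def killStep (L : ℝ≥0) (p : ℝ≥0 × ℝ≥0) : ℝ≥0 := kill L (p.1 * NNReal.sqrt p.2)

/-- The law after `n` steps of the killed multiplicative chain started at `1`. -/
def killedLaw (L : ℝ≥0) (ν : Measure ℝ≥0) : ℕ → Measure ℝ≥0
  | 0 => Measure.dirac 1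
  | n + 1 => ((killedLaw L ν n).prod ν).map (killStep L)

lemma kill_le (L z : ℝ≥0) : kill L z ≤ L := by
  unfold kill
  split_ifs with h
  · exact h
  · exact zero_le

lemma kill_of_le {L z : ℝ≥0} (h : z ≤ L) : kill L z = z := if_pos h

lemma measurable_kill (L : ℝ≥0) : Measurable (kill L) :=
  Measurable.ite measurableSet_Iic measurable_id measurable_const

lemma measurable_killStep (L : ℝ≥0) : Measurable (killStep L) :=
  (measurable_kill L).comp
    (measurable_fst.mul (NNReal.continuous_sqrt.measurable.comp measurable_snd))

variable {L : ℝ≥0} {ν : Measure ℝ≥0} [IsProbabilityMeasure ν]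

instance isProbabilityMeasure_killedLaw (n : ℕ) : IsProbabilityMeasure (killedLaw L ν n) := by
  induction n with
  | zero => exact Measure.dirac.isProbabilityMeasure
  | succ n ih => exact Measure.isProbabilityMeasure_map (measurable_killStep L).aemeasurable

lemma killedLaw_le (hL : 1 ≤ L) (n : ℕ) : ∀ᵐ z ∂(killedLaw L ν n), z ≤ L := by
  cases n with
  | zero => exact (ae_dirac_iff measurableSet_Iic).2 hL
  | succ n =>
    exact (ae_map_iff (measurable_killStep L).aemeasurable measurableSet_Iic).2
      (.of_forall fun p => kill_le _ _)

lemma lintegral_killedLaw_succ (n : ℕ) {φ : ℝ≥0 → ℝ≥0∞} (hφ : Measurable φ) :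
    ∫⁻ z, φ z ∂(killedLaw L ν (n + 1)) =
      ∫⁻ z, ∫⁻ y, φ (kill L (z * NNReal.sqrt y)) ∂ν ∂(killedLaw L ν n) := by
  rw [killedLaw, lintegral_map hφ (measurable_killStep L), lintegral_prod]
  · rfl
  · exact (hφ.comp (measurable_killStep L)).aemeasurable

/-- Monotone convergence gives any fraction of the mean below 1. A fraction above 1/2 is needed to
get a negative drift when `d = 2`; 3/4 leaves exactly the term z² below. -/
lemma exists_truncation (h1 : ∫⁻ y, (y : ℝ≥0∞) ∂ν = 1) :
    ∃ B : ℝ≥0, 1 ≤ B ∧ 3 ≤ 4 * ∫⁻ y in {y | NNReal.sqrt y ≤ B}, (y : ℝ≥0∞) ∂ν := by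
  let S (n : ℕ) : Set ℝ≥0 := {y | NNReal.sqrt y ≤ n}
  have hS (n : ℕ) : MeasurableSet (S n) := NNReal.continuous_sqrt.measurable measurableSet_Iic
  have hmono : Monotone S := fun m n hmn y hy => by
    have h : NNReal.sqrt y ≤ m := hy
    exact h.trans (by exact_mod_cast hmn)
  have hU : ⋃ n, S n = Set.univ := Set.eq_univ_of_forall fun y =>
    Set.mem_iUnion.2 (exists_nat_ge (NNReal.sqrt y))
  have ht := tendsto_measure_iUnion_atTop (μ := ν.withDensity fun y => (y : ℝ≥0∞)) hmono
  rw [hU, withDensity_apply _ .univ, setLIntegral_univ, h1] at ht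
  have hlt : (3 / 4 : ℝ≥0∞) < 1 := by
    rw [ENNReal.div_lt_iff (by simp) (by simp)]
    norm_num
  obtain ⟨n, hn, hn1⟩ := ((ht.eventually (lt_mem_nhds hlt)).and (Filter.eventually_ge_atTop 1)).exists
  refine ⟨n, by exact_mod_cast hn1, ?_⟩
  rw [Function.comp_apply, withDensity_apply _ (hS n)] at hn
  calc (3 : ℝ≥0∞) = 4 * (3 / 4) := by
        rw [ENNReal.mul_div_cancel (by simp) (by simp)]
    _ ≤ _ := by gcongr

/-- The Lyapunov function of the killed chain. -/
def lyapunov (A z : ℝ≥0) : ℝ≥0 := z * (A - z)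

lemma measurable_lyapunov (A : ℝ≥0) : Measurable (lyapunov A) :=
  measurable_id.mul (measurable_const.sub measurable_id)

lemma lyapunov_kill_le (L A z : ℝ≥0) : lyapunov A (kill L z) ≤ lyapunov A z := by
  unfold kill
  split_ifs
  · exact le_rfl
  · simp [lyapunov]

/-- Without truncation, the d-fold mean of z√y(A - z√y) is zA - dz², against zA - z² before the
step. Killing only lowers the function, which vanishes at 0. Subtraction being truncated, the
quadratic gain is kept only where √y ≤ B, since there z√y ≤ BL = A. -/
lemma lyapunov_step {d : ℕ} (hd : 2 ≤ d) (hsqrt : d * ∫⁻ y, (NNReal.sqrt y : ℝ≥0∞) ∂ν = 1)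
    {B : ℝ≥0} (hB : 1 ≤ B) (hB3 : 3 ≤ 4 * ∫⁻ y in {y | NNReal.sqrt y ≤ B}, (y : ℝ≥0∞) ∂ν)
    {z : ℝ≥0} (hz : z ≤ L) :
    2 * (d * ∫⁻ y, (lyapunov (B * L) (kill L (z * NNReal.sqrt y)) : ℝ≥0∞) ∂ν) + (z : ℝ≥0∞) ^ 2 ≤
      2 * lyapunov (B * L) z := by
  set A := B * L with hA
  set S : Set ℝ≥0 := {y | NNReal.sqrt y ≤ B} with hSdef
  have hS : MeasurableSet S := NNReal.continuous_sqrt.measurable measurableSet_Iic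
  have hzA : z ≤ A := hz.trans (le_mul_of_one_le_left zero_le hB)
  have hpt (y : ℝ≥0) : (lyapunov A (kill L (z * NNReal.sqrt y)) : ℝ≥0∞) +
      (z : ℝ≥0∞) ^ 2 * S.indicator (fun y => (y : ℝ≥0∞)) y ≤ (z * A : ℝ≥0) * NNReal.sqrt y := by
    have h1 := lyapunov_kill_le L A (z * NNReal.sqrt y)
    by_cases hy : y ∈ S
    · rw [Set.indicator_of_mem hy]
      have h2 : z * NNReal.sqrt y ≤ A := by
        rw [hA, mul_comm B]
        exact mul_le_mul' hz hy
      have h3 : lyapunov A (z * NNReal.sqrt y) + z ^ 2 * y = z * A * NNReal.sqrt y := by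
        have h4 : y = NNReal.sqrt y * NNReal.sqrt y := (NNReal.mul_self_sqrt y).symm
        unfold lyapunov
        conv_lhs => enter [2, 2]; rw [h4]
        calc _ = z * NNReal.sqrt y * (A - z * NNReal.sqrt y + z * NNReal.sqrt y) := by ring
          _ = _ := by rw [tsub_add_cancel_of_le h2]; ring
      have h5 := add_le_add_left h1 (z ^ 2 * y)
      rw [h3] at h5
      exact_mod_cast h5
    · rw [Set.indicator_of_notMem hy, mul_zero, add_zero]
      have h2 : lyapunov A (z * NNReal.sqrt y) ≤ z * A * NNReal.sqrt y := by
        unfold lyapunov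
        calc _ ≤ z * NNReal.sqrt y * A := by gcongr; exact tsub_le_self
          _ = _ := by ring
      exact_mod_cast h1.trans h2
  have hint := lintegral_mono (μ := ν) hpt
  rw [lintegral_add_right _ ((measurable_coe_nnreal_ennreal.indicator hS).const_mul _),
    lintegral_const_mul _ (measurable_coe_nnreal_ennreal.indicator hS), lintegral_indicator hS,
    lintegral_const_mul _ (NNReal.continuous_sqrt.measurable.coe_nnreal_ennreal)] at hint
  set I := ∫⁻ y, (lyapunov A (kill L (z * NNReal.sqrt y)) : ℝ≥0∞) ∂ν with hI
  set J := ∫⁻ y in S, (y : ℝ≥0∞) ∂ν with hJ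
  have h6 : (d : ℝ≥0∞) * I + d * ((z : ℝ≥0∞) ^ 2 * J) ≤ (z * A : ℝ≥0) := by
    calc _ = (d : ℝ≥0∞) * (I + (z : ℝ≥0∞) ^ 2 * J) := by ring
      _ ≤ d * ((z * A : ℝ≥0) * ∫⁻ y, (NNReal.sqrt y : ℝ≥0∞) ∂ν) := by gcongr
      _ = (z * A : ℝ≥0) * (d * ∫⁻ y, (NNReal.sqrt y : ℝ≥0∞) ∂ν) := by ring
      _ = _ := by rw [hsqrt, mul_one]
  have h7 : lyapunov A z + z ^ 2 = z * A := by
    unfold lyapunov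
    calc _ = z * (A - z + z) := by ring
      _ = _ := by rw [tsub_add_cancel_of_le hzA]
  have h8 : 2 * ((d : ℝ≥0∞) * I) + 3 * (z : ℝ≥0∞) ^ 2 ≤ 2 * (z * A : ℝ≥0) := by
    calc 2 * ((d : ℝ≥0∞) * I) + 3 * (z : ℝ≥0∞) ^ 2
        ≤ 2 * ((d : ℝ≥0∞) * I) + (4 * J) * (z : ℝ≥0∞) ^ 2 := by gcongr
      _ = 2 * ((d : ℝ≥0∞) * I) + 2 * ((2 : ℕ) * ((z : ℝ≥0∞) ^ 2 * J)) := by push_cast; ring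
      _ ≤ 2 * ((d : ℝ≥0∞) * I) + 2 * (d * ((z : ℝ≥0∞) ^ 2 * J)) := by gcongr
      _ = 2 * ((d : ℝ≥0∞) * I + d * ((z : ℝ≥0∞) ^ 2 * J)) := by ring
      _ ≤ _ := by gcongr
  rw [← h7] at h8
  push_cast at h8
  have h9 : (2 : ℝ≥0∞) * (z : ℝ≥0∞) ^ 2 ≠ ∞ := by finiteness
  refine (ENNReal.add_le_add_iff_right h9).1 ?_
  calc _ = 2 * ((d : ℝ≥0∞) * I) + 3 * (z : ℝ≥0∞) ^ 2 := by ring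
    _ ≤ _ := h8
    _ = _ := by ring

/-- The killed chain has a finite weighted sum of second moments. -/
lemma tsum_killedLaw_sq_ne_top {d : ℕ} (hd : 2 ≤ d) (h1 : ∫⁻ y, (y : ℝ≥0∞) ∂ν = 1)
    (hsqrt : d * ∫⁻ y, (NNReal.sqrt y : ℝ≥0∞) ∂ν = 1) (hL : 1 ≤ L) :
    ∑' n, (d : ℝ≥0∞) ^ n * ∫⁻ z, (z : ℝ≥0∞) ^ 2 ∂(killedLaw L ν n) ≠ ∞ := by
  obtain ⟨B, hB, hB3⟩ := exists_truncation h1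
  have hφ : Measurable fun z : ℝ≥0 => (lyapunov (B * L) z : ℝ≥0∞) :=
    (measurable_lyapunov _).coe_nnreal_ennreal
  let M (n : ℕ) : ℝ≥0∞ := (d : ℝ≥0∞) ^ n * ∫⁻ z, (lyapunov (B * L) z : ℝ≥0∞) ∂(killedLaw L ν n)
  let Q (n : ℕ) : ℝ≥0∞ := (d : ℝ≥0∞) ^ n * ∫⁻ z, (z : ℝ≥0∞) ^ 2 ∂(killedLaw L ν n)
  have hstep (n : ℕ) : 2 * M (n + 1) + Q n ≤ 2 * M n := by
    have hm : Measurable fun z : ℝ≥0 =>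
        ∫⁻ y, (lyapunov (B * L) (kill L (z * NNReal.sqrt y)) : ℝ≥0∞) ∂ν :=
      Measurable.lintegral_prod_right' (f := fun p => (lyapunov (B * L) (killStep L p) : ℝ≥0∞))
        (hφ.comp (measurable_killStep L))
    have h2 := lintegral_mono_ae ((killedLaw_le (ν := ν) hL n).mono fun z hz =>
      lyapunov_step hd hsqrt hB hB3 hz)
    rw [lintegral_add_left ((hm.const_mul _).const_mul _),
      lintegral_const_mul _ (hm.const_mul _), lintegral_const_mul _ hm, lintegral_const_mul _ hφ,
      ← lintegral_killedLaw_succ n hφ] at h2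
    calc 2 * M (n + 1) + Q n = (d : ℝ≥0∞) ^ n * (2 * (d * ∫⁻ z, (lyapunov (B * L) z : ℝ≥0∞)
          ∂(killedLaw L ν (n + 1))) + ∫⁻ z, (z : ℝ≥0∞) ^ 2 ∂(killedLaw L ν n)) := by
          simp only [M, Q]; ring
      _ ≤ (d : ℝ≥0∞) ^ n * (2 * ∫⁻ z, (lyapunov (B * L) z : ℝ≥0∞) ∂(killedLaw L ν n)) := by
          gcongr
      _ = _ := by simp only [M]; ring
  -- Telescoping the drift inequality bounds all partial sums by the initial value of the Lyapunov
  -- function.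
  have hsum (N : ℕ) : 2 * M N + ∑ n ∈ Finset.range N, Q n ≤ 2 * M 0 := by
    induction N with
    | zero => simp
    | succ N ih =>
      rw [Finset.sum_range_succ]
      calc _ = 2 * M (N + 1) + Q N + ∑ n ∈ Finset.range N, Q n := by ring
        _ ≤ 2 * M N + ∑ n ∈ Finset.range N, Q n := by gcongr; exact hstep N
        _ ≤ _ := ih
  have hM0 : 2 * M 0 ≠ ∞ := by
    simp only [M, killedLaw, pow_zero, one_mul]
    rw [lintegral_dirac' _ hφ]
    finiteness
  refine ne_top_of_le_ne_top hM0 ?_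
  rw [ENNReal.tsum_eq_iSup_nat]
  exact iSup_le fun N => le_add_self.trans (hsum N)

/-- The weighted sum of the killing probabilities is at most `1 / L`. -/
lemma tsum_killing_le {d : ℕ} (hsqrt : d * ∫⁻ y, (NNReal.sqrt y : ℝ≥0∞) ∂ν = 1) :
    L * ∑' n, (d : ℝ≥0∞) ^ (n + 1) *
      ((killedLaw L ν n).prod ν) {p | L < p.1 * NNReal.sqrt p.2} ≤ 1 := by
  have hs : Measurable fun y : ℝ≥0 => (NNReal.sqrt y : ℝ≥0∞) :=
    NNReal.continuous_sqrt.measurable.coe_nnreal_ennreal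
  have hS : MeasurableSet {p : ℝ≥0 × ℝ≥0 | L < p.1 * NNReal.sqrt p.2} :=
    (measurable_fst.mul (NNReal.continuous_sqrt.measurable.comp measurable_snd)) measurableSet_Ioi
  let M (n : ℕ) : ℝ≥0∞ := (d : ℝ≥0∞) ^ n * ∫⁻ z, (z : ℝ≥0∞) ∂(killedLaw L ν n)
  let R (n : ℕ) : ℝ≥0∞ := (d : ℝ≥0∞) ^ (n + 1) *
      ((killedLaw L ν n).prod ν) {p | L < p.1 * NNReal.sqrt p.2}
  -- The d-fold mean would be conserved without killing, and each killing removes a value above `L`.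
  have hstep (n : ℕ) : M (n + 1) + L * R n ≤ M n := by
    have h2 : ∫⁻ z, (z : ℝ≥0∞) ∂(killedLaw L ν (n + 1)) +
        L * ((killedLaw L ν n).prod ν) {p | L < p.1 * NNReal.sqrt p.2} ≤
        (∫⁻ z, (z : ℝ≥0∞) ∂(killedLaw L ν n)) * ∫⁻ y, (NNReal.sqrt y : ℝ≥0∞) ∂ν := by
      rw [← lintegral_prod_mul measurable_coe_nnreal_ennreal.aemeasurable hs.aemeasurable,
        killedLaw, lintegral_map measurable_coe_nnreal_ennreal (measurable_killStep L),
        ← lintegral_indicator_const hS,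
        ← lintegral_add_left (measurable_killStep L).coe_nnreal_ennreal]
      refine lintegral_mono fun p => ?_
      by_cases hp : L < p.1 * NNReal.sqrt p.2
      · rw [Set.indicator_of_mem (by exact hp)]
        have : killStep L p = 0 := if_neg (not_le.2 hp)
        rw [this, ENNReal.coe_zero, zero_add, ← ENNReal.coe_mul]
        exact ENNReal.coe_le_coe.2 hp.le
      · rw [Set.indicator_of_notMem (by exact hp), add_zero]
        have : killStep L p = p.1 * NNReal.sqrt p.2 := kill_of_le (not_lt.1 hp)
        rw [this, ENNReal.coe_mul]
    calc M (n + 1) + L * R n = (d : ℝ≥0∞) ^ (n + 1) * (∫⁻ z, (z : ℝ≥0∞) ∂(killedLaw L ν (n + 1)) +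
        L * ((killedLaw L ν n).prod ν) {p | L < p.1 * NNReal.sqrt p.2}) := by
          simp only [M, R]; ring
      _ ≤ (d : ℝ≥0∞) ^ (n + 1) * ((∫⁻ z, (z : ℝ≥0∞) ∂(killedLaw L ν n)) *
          ∫⁻ y, (NNReal.sqrt y : ℝ≥0∞) ∂ν) := by gcongr
      _ = M n * (d * ∫⁻ y, (NNReal.sqrt y : ℝ≥0∞) ∂ν) := by simp only [M]; ring
      _ = _ := by rw [hsqrt, mul_one]
  have hsum (N : ℕ) : M N + ∑ n ∈ Finset.range N, L * R n ≤ M 0 := by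
    induction N with
    | zero => simp
    | succ N ih =>
      rw [Finset.sum_range_succ]
      calc _ = M (N + 1) + L * R N + ∑ n ∈ Finset.range N, L * R n := by ring
        _ ≤ M N + ∑ n ∈ Finset.range N, L * R n := by gcongr; exact hstep N
        _ ≤ _ := ih
  have hM0 : M 0 = 1 := by
    simp only [M, killedLaw, pow_zero, one_mul]
    rw [lintegral_dirac' _ measurable_coe_nnreal_ennreal]
    rfl
  rw [← ENNReal.tsum_mul_left, ENNReal.tsum_eq_iSup_nat, ← hM0]
  exact iSup_le fun N => le_add_self.trans (hsum N)

end KilledChain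

/-! ### Hellinger affinity and a positive density. -/

section Hellinger

variable {Y : Type*} [MeasurableSpace Y] (μ₀ μ₁ : Measure Y) [IsProbabilityMeasure μ₀]
  [IsProbabilityMeasure μ₁]

/-- Expanding the square, both densities integrate to 1 and only the cross term, the affinity,
remains. -/
lemma ofReal_one_sub_hellingerSq :
    ENNReal.ofReal (1 - hellingerSq μ₀ μ₁) =
      ∫⁻ y, (NNReal.sqrt ((μ₀.rnDeriv (μ₀ + μ₁) y).toNNReal * (μ₁.rnDeriv (μ₀ + μ₁) y).toNNReal) :
        ℝ≥0∞) ∂(μ₀ + μ₁) := by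
  set ζ := μ₀ + μ₁ with hζ
  have h0 : μ₀ ≪ ζ := Measure.absolutelyContinuous_of_le (Measure.le_add_right le_rfl)
  have h1 : μ₁ ≪ ζ := Measure.absolutelyContinuous_of_le (Measure.le_add_left le_rfl)
  set a : Y → ℝ := fun y => (μ₀.rnDeriv ζ y).toReal with ha
  set b : Y → ℝ := fun y => (μ₁.rnDeriv ζ y).toReal with hb
  have ha0 (y : Y) : 0 ≤ a y := ENNReal.toReal_nonneg
  have hb0 (y : Y) : 0 ≤ b y := ENNReal.toReal_nonneg
  have ham : Measurable a := (Measure.measurable_rnDeriv _ _).ennreal_toReal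
  have hbm : Measurable b := (Measure.measurable_rnDeriv _ _).ennreal_toReal
  have hai : Integrable a ζ := Measure.integrable_toReal_rnDeriv
  have hbi : Integrable b ζ := Measure.integrable_toReal_rnDeriv
  have ha1 : ∫ y, a y ∂ζ = 1 := by simp [a, Measure.integral_toReal_rnDeriv h0]
  have hb1 : ∫ y, b y ∂ζ = 1 := by simp [b, Measure.integral_toReal_rnDeriv h1]
  have hsi : Integrable (fun y => √(a y * b y)) ζ := by
    refine (hai.add hbi).mono' (ham.mul hbm).sqrt.aestronglyMeasurable (.of_forall fun y => ?_)
    rw [Real.norm_of_nonneg (Real.sqrt_nonneg _)]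
    refine (Real.sqrt_le_left (add_nonneg (ha0 y) (hb0 y))).2 ?_
    nlinarith [ha0 y, hb0 y, mul_nonneg (ha0 y) (hb0 y)]
  have hH : 1 - hellingerSq μ₀ μ₁ = ∫ y, √(a y * b y) ∂ζ := by
    have h2 : ∀ y, (√(a y) - √(b y)) ^ 2 = a y + b y - 2 * √(a y * b y) := fun y => by
      rw [Real.sqrt_mul (ha0 y), sub_sq, Real.sq_sqrt (ha0 y), Real.sq_sqrt (hb0 y)]
      ring
    change 1 - 1 / 2 * ∫ y, (√(a y) - √(b y)) ^ 2 ∂ζ = _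
    simp_rw [h2]
    rw [integral_sub (f := fun y => a y + b y) (hai.add hbi) (hsi.const_mul 2), integral_add hai hbi, integral_const_mul, ha1,
      hb1]
    ring
  rw [hH, ofReal_integral_eq_lintegral_ofReal hsi (.of_forall fun y => Real.sqrt_nonneg _)]
  refine lintegral_congr fun y => ?_
  have ha2 : (a y).toNNReal = (μ₀.rnDeriv ζ y).toNNReal := Real.toNNReal_coe
  have hb2 : (b y).toNNReal = (μ₁.rnDeriv ζ y).toNNReal := Real.toNNReal_coe
  rw [ENNReal.ofReal, Real.sqrt, Real.toNNReal_coe, Real.toNNReal_mul (ha0 y), ha2, hb2]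

/-- A strictly positive version of the Radon–Nikodym derivative of two equivalent measures. -/
lemma exists_pos_density (h01 : μ₀ ≪ μ₁) (h10 : μ₁ ≪ μ₀) :
    ∃ f : Y → ℝ≥0, Measurable f ∧ (∀ y, f y ≠ 0) ∧ ∫⁻ y, (f y : ℝ≥0∞) ∂μ₀ = 1 ∧
      ∫⁻ y, ((f y)⁻¹ : ℝ≥0) ∂μ₁ = 1 ∧
      ∫⁻ y, (NNReal.sqrt (f y) : ℝ≥0∞) ∂μ₀ = ENNReal.ofReal (1 - hellingerSq μ₀ μ₁) ∧
      ∫⁻ y, (NNReal.sqrt (f y)⁻¹ : ℝ≥0∞) ∂μ₁ = ENNReal.ofReal (1 - hellingerSq μ₀ μ₁) := by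
  rw [ofReal_one_sub_hellingerSq]
  set ζ := μ₀ + μ₁ with hζ
  have h0 : μ₀ ≪ ζ := Measure.absolutelyContinuous_of_le (Measure.le_add_right le_rfl)
  have h1 : μ₁ ≪ ζ := Measure.absolutelyContinuous_of_le (Measure.le_add_left le_rfl)
  have hz0 : ζ ≪ μ₀ := Measure.AbsolutelyContinuous.add_left .rfl h10
  have hz1 : ζ ≪ μ₁ := Measure.AbsolutelyContinuous.add_left h01 .rfl
  set a : Y → ℝ≥0 := fun y => (μ₀.rnDeriv ζ y).toNNReal with ha
  set b : Y → ℝ≥0 := fun y => (μ₁.rnDeriv ζ y).toNNReal with hb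
  have ham : Measurable a := (Measure.measurable_rnDeriv _ _).ennreal_toNNReal
  have hbm : Measurable b := (Measure.measurable_rnDeriv _ _).ennreal_toNNReal
  have hμa : ζ.withDensity (fun y => (a y : ℝ≥0∞)) = μ₀ := by
    refine (withDensity_congr_ae ?_).trans (Measure.withDensity_rnDeriv_eq μ₀ ζ h0)
    filter_upwards [Measure.rnDeriv_lt_top μ₀ ζ] with y hy
    exact ENNReal.coe_toNNReal hy.ne
  have hμb : ζ.withDensity (fun y => (b y : ℝ≥0∞)) = μ₁ := by
    refine (withDensity_congr_ae ?_).trans (Measure.withDensity_rnDeriv_eq μ₁ ζ h1)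
    filter_upwards [Measure.rnDeriv_lt_top μ₁ ζ] with y hy
    exact ENNReal.coe_toNNReal hy.ne
  have hpos : ∀ᵐ y ∂ζ, a y ≠ 0 ∧ b y ≠ 0 := by
    filter_upwards [hz0.ae_le (Measure.rnDeriv_pos h0), hz1.ae_le (Measure.rnDeriv_pos h1),
      Measure.rnDeriv_lt_top μ₀ ζ, Measure.rnDeriv_lt_top μ₁ ζ] with y h2 h3 h4 h5
    exact ⟨(ENNReal.toNNReal_pos h2.ne' h4.ne).ne', (ENNReal.toNNReal_pos h3.ne' h5.ne).ne'⟩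
  have hia (φ : Y → ℝ≥0) (hφ : Measurable φ) :
      ∫⁻ y, (φ y : ℝ≥0∞) ∂μ₀ = ∫⁻ y, (a y * φ y : ℝ≥0) ∂ζ := by
    conv_lhs => rw [← hμa]
    rw [lintegral_withDensity_eq_lintegral_mul _ ham.coe_nnreal_ennreal hφ.coe_nnreal_ennreal]
    simp
  have hib (φ : Y → ℝ≥0) (hφ : Measurable φ) :
      ∫⁻ y, (φ y : ℝ≥0∞) ∂μ₁ = ∫⁻ y, (b y * φ y : ℝ≥0) ∂ζ := by
    conv_lhs => rw [← hμb]
    rw [lintegral_withDensity_eq_lintegral_mul _ hbm.coe_nnreal_ennreal hφ.coe_nnreal_ennreal]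
    simp
  have ha1 : ∫⁻ y, (a y : ℝ≥0∞) ∂ζ = 1 := by
    rw [← setLIntegral_univ, ← withDensity_apply _ .univ, hμa, measure_univ]
  have hb1 : ∫⁻ y, (b y : ℝ≥0∞) ∂ζ = 1 := by
    rw [← setLIntegral_univ, ← withDensity_apply _ .univ, hμb, measure_univ]
  have hset : MeasurableSet {y | a y ≠ 0 ∧ b y ≠ 0} :=
    (ham (measurableSet_singleton 0).compl).inter (hbm (measurableSet_singleton 0).compl)
  classical
  -- The default value 1 on the null set where a density vanishes makes `f` nonzero everywhere, so
  -- the cocycle identities hold for every configuration.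
  set f : Y → ℝ≥0 := fun y => if a y ≠ 0 ∧ b y ≠ 0 then b y / a y else 1 with hf
  have hfm : Measurable f := Measurable.ite hset (hbm.div ham) measurable_const
  have hfe : ∀ᵐ y ∂ζ, f y = b y / a y := hpos.mono fun y hy => if_pos hy
  refine ⟨f, hfm, fun y => ?_, ?_, ?_, ?_, ?_⟩
  · simp only [f]
    split_ifs with h
    · exact div_ne_zero h.2 h.1
    · exact one_ne_zero
  · rw [hia f hfm, ← hb1]
    refine lintegral_congr_ae ?_
    filter_upwards [hfe, hpos] with y h2 h3
    rw [h2, mul_div_cancel₀ _ h3.1]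
  · rw [hib (fun y => (f y)⁻¹) hfm.inv, ← ha1]
    refine lintegral_congr_ae ?_
    filter_upwards [hfe, hpos] with y h2 h3
    rw [h2, inv_div, mul_div_cancel₀ _ h3.2]
  · rw [hia (fun y => NNReal.sqrt (f y)) (NNReal.continuous_sqrt.measurable.comp hfm)]
    refine lintegral_congr_ae ?_
    filter_upwards [hfe, hpos] with y h2 h3
    congr 1
    rw [h2]
    -- With a = √(a²), the product a√(b/a) becomes √(ab).
    conv_lhs => enter [1]; rw [← NNReal.sqrt_sq (a y)]
    rw [← NNReal.sqrt_mul]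
    congr 1
    field_simp [h3.1]
    rfl
  · rw [hib (fun y => NNReal.sqrt (f y)⁻¹) (NNReal.continuous_sqrt.measurable.comp hfm.inv)]
    refine lintegral_congr_ae ?_
    filter_upwards [hfe, hpos] with y h2 h3
    congr 1
    rw [h2]
    conv_lhs => enter [1]; rw [← NNReal.sqrt_sq (b y)]
    rw [← NNReal.sqrt_mul]
    congr 1
    field_simp [h3.2]
    exact mul_comm _ _

end Hellinger

/-! ### Sphere sizes in a regular graph. -/

section Spheres

variable {V : Type*} {T : SimpleGraph V}

lemma exists_parent (hc : T.Connected) {ρ w : V} (hw : w ≠ ρ) :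
    ∃ p, T.Adj p w ∧ T.dist ρ w = T.dist ρ p + 1 := by
  obtain ⟨p, hp⟩ := hc.exists_walk_length_eq_dist w ρ
  cases p with
  | nil => exact absurd rfl hw
  | @cons _ u _ h p =>
    refine ⟨u, h.symm, ?_⟩
    have h1 := SimpleGraph.dist_le p
    have h2 := hc.dist_triangle (u := w) (v := u) (w := ρ)
    rw [SimpleGraph.dist_eq_one_iff_adj.2 h] at h2
    rw [SimpleGraph.Walk.length_cons] at hp
    rw [SimpleGraph.dist_comm (u := ρ), SimpleGraph.dist_comm (u := ρ)]
    omega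

open Classical in
/-- A neighbour of `w` that is closer to the root (and the root itself if `w` is the root). -/
def parent (hc : T.Connected) (ρ w : V) : V :=
  if hw : w ≠ ρ then (exists_parent hc hw).choose else ρ

lemma adj_parent (hc : T.Connected) {ρ w : V} (hw : w ≠ ρ) : T.Adj (parent hc ρ w) w := by
  rw [parent, dif_pos hw]
  exact (exists_parent hc hw).choose_spec.1

lemma dist_parent (hc : T.Connected) {ρ w : V} (hw : w ≠ ρ) :
    T.dist ρ w = T.dist ρ (parent hc ρ w) + 1 := by
  rw [parent, dif_pos hw]
  exact (exists_parent hc hw).choose_spec.2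

lemma ne_root_of_dist {ρ w : V} {n : ℕ} (h : T.dist ρ w = n + 1) : w ≠ ρ := by
  rintro rfl
  simp at h

variable [T.LocallyFinite]

/-- Each vertex other than the root has at most `d` neighbours besides its parent; the factor 2
absorbs the d + 1 ≤ 2d neighbours of the root. -/
lemma card_sphere_le (hc : T.Connected) {d : ℕ} (hd : 1 ≤ d) (hreg : T.IsRegularOfDegree (d + 1))
    (ρ : V) (n : ℕ) : (finite_sphere hc ρ n).toFinset.card ≤ 2 * d ^ n := by
  classical
  induction n with
  | zero =>
    have : (finite_sphere hc ρ 0).toFinset ⊆ {ρ} := fun u hu => by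
      have h : T.dist ρ u = 0 := by simpa using hu
      exact Finset.mem_singleton.2 (hc.dist_eq_zero_iff.1 h).symm
    have := Finset.card_le_card this
    rw [Finset.card_singleton] at this
    rw [pow_zero]
    omega
  | succ n ih =>
    rcases Nat.eq_zero_or_pos n with rfl | hn
    · have : (finite_sphere hc ρ (0 + 1)).toFinset ⊆ T.neighborFinset ρ := fun u hu => by
        have h : T.dist ρ u = 1 := by simpa using hu
        rw [SimpleGraph.mem_neighborFinset]
        exact SimpleGraph.dist_eq_one_iff_adj.1 h
      have := Finset.card_le_card this
      rw [SimpleGraph.card_neighborFinset_eq_degree, hreg ρ] at this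
      rw [pow_one]
      omega
    · have : (finite_sphere hc ρ (n + 1)).toFinset ⊆ (finite_sphere hc ρ n).toFinset.biUnion
          fun v => (T.neighborFinset v).erase (parent hc ρ v) := fun u hu => by
        have h : T.dist ρ u = n + 1 := by simpa using hu
        have hu0 := ne_root_of_dist h
        have h1 := dist_parent hc hu0
        refine Finset.mem_biUnion.2 ⟨parent hc ρ u, ?_, ?_⟩
        · rw [Set.Finite.mem_toFinset]
          change T.dist ρ _ = n
          omega
        · rw [Finset.mem_erase, SimpleGraph.mem_neighborFinset]
          refine ⟨fun he => ?_, adj_parent hc hu0⟩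
          have h2 : parent hc ρ u ≠ ρ := by
            intro h3
            rw [h3, SimpleGraph.dist_self] at h1
            omega
          have h3 := dist_parent hc h2
          rw [← he] at h3
          omega
      refine (Finset.card_le_card this).trans ((Finset.card_biUnion_le_card_mul _ _ d ?_).trans ?_)
      · intro v hv
        have hv' : T.dist ρ v = n := by simpa using hv
        have hv0 : v ≠ ρ := by
          rintro rfl
          simp at hv'
          omega
        rw [Finset.card_erase_of_mem, SimpleGraph.card_neighborFinset_eq_degree, hreg v]
        · rfl
        · rw [SimpleGraph.mem_neighborFinset]
          exact (adj_parent hc hv0).symm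
      · rw [pow_succ]
        nlinarith

lemma tsum_dist_le (hc : T.Connected) {d : ℕ} (hd : 1 ≤ d) (hreg : T.IsRegularOfDegree (d + 1))
    (ρ : V) (φ : ℕ → ℝ≥0∞) :
    ∑' w, φ (T.dist ρ w) ≤ 2 * ∑' n, (d : ℝ≥0∞) ^ n * φ n := by
  rw [← (Equiv.sigmaFiberEquiv fun w => T.dist ρ w).tsum_eq, ENNReal.tsum_sigma',
    ← ENNReal.tsum_mul_left]
  refine ENNReal.tsum_le_tsum fun n => ?_
  have h1 : ∀ w : {w // T.dist ρ w = n},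
      φ (T.dist ρ (Equiv.sigmaFiberEquiv (fun w => T.dist ρ w) ⟨n, w⟩)) = φ n := fun w => by
    change φ (T.dist ρ w) = _
    rw [w.2]
  rw [tsum_congr h1]
  have : Fintype {w // T.dist ρ w = n} := (finite_sphere hc ρ n).fintype
  rw [tsum_fintype, Finset.sum_const, nsmul_eq_mul, ← mul_assoc]
  gcongr
  have h2 := card_sphere_le hc hd hreg ρ n
  have h3 : (Finset.univ : Finset {w // T.dist ρ w = n}).card =
      (finite_sphere hc ρ n).toFinset.card := by
    rw [Finset.card_univ]
    rw [Fintype.card_eq_nat_card, ← Set.ncard_eq_toFinset_card _ (finite_sphere hc ρ n)]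
    rfl
  rw [h3]
  exact_mod_cast h2

end Spheres

/-! ### The killed weights on the tree and almost sure summability. -/

section KilledWeight

variable {V : Type*} {T : SimpleGraph V} {X₀ : Type*}

/-- The square root of the weight of a vertex at distance `n` from the root, killed once it exceeds
the level `L` along the geodesic from the root. -/
def killedWeight (hc : T.Connected) (f : X₀ → ℝ≥0) (L : ℝ≥0) (ρ : V) :
    ℕ → V → (T.Dart → X₀) → ℝ≥0
  | 0, _, _ => 1
  | n + 1, w, x => killStep L
      (killedWeight hc f L ρ n (parent hc ρ w) x, weight hc f x (parent hc ρ w) w)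

/-- The event that the killed weight dies at the vertex `w`, at distance `n + 1` from the root. -/
def killingEvent (hc : T.Connected) (f : X₀ → ℝ≥0) (L : ℝ≥0) (ρ : V) (n : ℕ) (w : V) :
    Set (T.Dart → X₀) :=
  {x | L < killedWeight hc f L ρ n (parent hc ρ w) x *
    NNReal.sqrt (weight hc f x (parent hc ρ w) w)}

variable {f : X₀ → ℝ≥0} {L : ℝ≥0} {ρ : V}

/-- As long as no killing occurs, the killed weight is the square root of the weight. -/
lemma killedWeight_sq_eq (hT : T.IsTree) (hf : ∀ y, f y ≠ 0) {x : T.Dart → X₀}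
    (hx : ∀ n w, T.dist ρ w = n + 1 → x ∉ killingEvent hT.connected f L ρ n w) (n : ℕ) :
    ∀ w, T.dist ρ w = n → killedWeight hT.connected f L ρ n w x ^ 2 =
      weight hT.connected f x ρ w := by
  induction n with
  | zero =>
    intro w hw
    obtain rfl := hT.connected.dist_eq_zero_iff.1 hw
    simp [killedWeight, weight_self hT hf]
  | succ n ih =>
    intro w hw
    have h1 := dist_parent hT.connected (ne_root_of_dist hw)
    have h2 := ih (parent hT.connected ρ w) (by omega)
    have h3 : ¬ (L < _) := hx n w hw
    rw [killedWeight, killStep, kill_of_le (not_lt.1 h3), mul_pow, h2, NNReal.sq_sqrt,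
      weight_mul hT hf]

variable [MeasurableSpace X₀] [T.LocallyFinite]

lemma measurable_weight_coord (hT : T.IsTree) (hf : Measurable f) (hf0 : ∀ y, f y ≠ 0) {v w : V}
    (h : T.Adj v w) :
    Measurable[⨆ e ∈ ({⟨(w, v), h.symm⟩, ⟨(v, w), h⟩} : Set T.Dart),
      MeasurableSpace.comap (fun x : T.Dart → X₀ => x e) inferInstance]
      fun x : T.Dart → X₀ => weight hT.connected f x v w := by
  have h1 : (fun x : T.Dart → X₀ => weight hT.connected f x v w) =
      fun x => f (x ⟨(w, v), h.symm⟩) / f (x ⟨(v, w), h⟩) := by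
    funext x
    rw [weight_eq hT hf0 (.cons h .nil : T.Walk v w)]
    simp [walkWeight, stepRatio]
  have h2 (e : T.Dart) (he : e ∈ ({⟨(w, v), h.symm⟩, ⟨(v, w), h⟩} : Set T.Dart)) :
      Measurable[⨆ e ∈ ({⟨(w, v), h.symm⟩, ⟨(v, w), h⟩} : Set T.Dart),
        MeasurableSpace.comap (fun x : T.Dart → X₀ => x e) inferInstance]
        fun x : T.Dart → X₀ => f (x e) :=
    hf.comp ((comap_measurable _).mono
      (le_biSup (fun e => MeasurableSpace.comap (fun x : T.Dart → X₀ => x e) inferInstance) he)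
      le_rfl)
  rw [h1]
  exact (h2 _ (by simp)).div (h2 _ (by simp))

/-- The explicit σ-algebra records that only darts inside the ball of radius `n` are read, which
gives independence from the next step outwards. -/
lemma measurable_killedWeight_coord (hT : T.IsTree) (hf : Measurable f) (hf0 : ∀ y, f y ≠ 0)
    (n : ℕ) : ∀ w, T.dist ρ w = n →
    Measurable[⨆ e ∈ {e : T.Dart | T.dist ρ e.fst ≤ n ∧ T.dist ρ e.snd ≤ n},
      MeasurableSpace.comap (fun x : T.Dart → X₀ => x e) inferInstance]
      (killedWeight hT.connected f L ρ n w) := by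
  induction n with
  | zero => exact fun w _ => measurable_const
  | succ n ih =>
    intro w hw
    have h1 := dist_parent hT.connected (ne_root_of_dist hw)
    refine (measurable_killStep L).comp (Measurable.prodMk ?_ ?_)
    · refine (ih _ (by omega)).mono (biSup_mono fun e he => ?_) le_rfl
      exact ⟨he.1.trans n.le_succ, he.2.trans n.le_succ⟩
    · have h2 : T.dist ρ (parent hT.connected ρ w) ≤ n + 1 := by omega
      refine (measurable_weight_coord hT hf hf0 (adj_parent _ (ne_root_of_dist hw))).mono
        (biSup_mono fun e he => ?_) le_rfl
      rcases he with rfl | rfl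
      · exact ⟨hw.le, h2⟩
      · exact ⟨h2, hw.le⟩

lemma coord_le (S : Set T.Dart) :
    (⨆ e ∈ S, MeasurableSpace.comap (fun x : T.Dart → X₀ => x e) inferInstance) ≤
      (inferInstance : MeasurableSpace (T.Dart → X₀)) :=
  iSup₂_le fun e _ => (measurable_pi_apply e).comap_le

lemma measurable_killedWeight (hT : T.IsTree) (hf : Measurable f) (hf0 : ∀ y, f y ≠ 0) {n : ℕ}
    {w : V} (hw : T.dist ρ w = n) : Measurable (killedWeight hT.connected f L ρ n w) :=
  (measurable_killedWeight_coord hT hf hf0 n w hw).mono (coord_le _) le_rfl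

variable (μ₀ μ₁ : Measure X₀) [IsProbabilityMeasure μ₀] [IsProbabilityMeasure μ₁]

/-- The law of the factor of a step away from the root. -/
def stepLaw (f : X₀ → ℝ≥0) : Measure ℝ≥0 := (μ₀.prod μ₁).map fun p => f p.1 / f p.2

lemma measurable_div_comp (hf : Measurable f) : Measurable fun p : X₀ × X₀ => f p.1 / f p.2 :=
  (hf.comp measurable_fst).div (hf.comp measurable_snd)

lemma isProbabilityMeasure_stepLaw (hf : Measurable f) :
    IsProbabilityMeasure (stepLaw μ₀ μ₁ f) :=
  Measure.isProbabilityMeasure_map (measurable_div_comp hf).aemeasurable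

instance isProbabilityMeasure_bernoulliMeasure :
    IsProbabilityMeasure (bernoulliMeasure T ρ μ₀ μ₁) := by
  unfold bernoulliMeasure
  infer_instance

/-- The dart from `w` to its parent points to the root and has law `μ₀`, the reversed dart has law
`μ₁`, and distinct coordinates are independent. -/
lemma map_weight_parent (hT : T.IsTree) (hf : Measurable f) (hf0 : ∀ y, f y ≠ 0) {w : V}
    (hw : w ≠ ρ) :
    (bernoulliMeasure T ρ μ₀ μ₁).map
      (fun x => weight hT.connected f x (parent hT.connected ρ w) w) = stepLaw μ₀ μ₁ f := by
  have h := adj_parent hT.connected hw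
  have h1 := dist_parent hT.connected hw
  set v := parent hT.connected ρ w with hv
  have h2 : (fun x : T.Dart → X₀ => weight hT.connected f x v w) =
      (fun p : X₀ × X₀ => f p.1 / f p.2) ∘ fun x => (x ⟨(w, v), h.symm⟩, x ⟨(v, w), h⟩) := by
    funext x
    rw [weight_eq hT hf0 (.cons h .nil : T.Walk v w)]
    simp [walkWeight, stepRatio]
  have hne : (⟨(w, v), h.symm⟩ : T.Dart) ≠ ⟨(v, w), h⟩ := by
    intro he
    have := congrArg (fun e : T.Dart => e.fst) he
    exact h.ne' this
  rw [h2, ← Measure.map_map (measurable_div_comp hf)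
    ((measurable_pi_apply _).prodMk (measurable_pi_apply _)), bernoulliMeasure,
    Measure.infinitePi_map_eval_prod hne]
  have h3 : edgeMeasure ρ μ₀ μ₁ (⟨(w, v), h.symm⟩ : T.Dart) = μ₀ :=
    if_pos (by change T.dist ρ v < T.dist ρ w; omega)
  have h4 : edgeMeasure ρ μ₀ μ₁ (⟨(v, w), h⟩ : T.Dart) = μ₁ :=
    if_neg (by change ¬ (T.dist ρ w < T.dist ρ v); omega)
  rw [h3, h4, stepLaw]

lemma indepFun_killedWeight (hT : T.IsTree) (hf : Measurable f) (hf0 : ∀ y, f y ≠ 0) {n : ℕ}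
    {w : V} (hw : T.dist ρ w = n + 1) :
    IndepFun (killedWeight hT.connected f L ρ n (parent hT.connected ρ w))
      (fun x => weight hT.connected f x (parent hT.connected ρ w) w)
      (bernoulliMeasure T ρ μ₀ μ₁) := by
  have hw0 := ne_root_of_dist hw
  have h1 := dist_parent hT.connected hw0
  have hi : iIndep (fun e => MeasurableSpace.comap (fun x : T.Dart → X₀ => x e) inferInstance)
      (bernoulliMeasure T ρ μ₀ μ₁) :=
    iIndepFun_infinitePi (P := fun e : T.Dart => edgeMeasure ρ μ₀ μ₁ e) (X := fun _ y => y)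
      fun _ => measurable_id
  have hd : Disjoint {e : T.Dart | T.dist ρ e.fst ≤ n ∧ T.dist ρ e.snd ≤ n}
      {⟨(w, parent hT.connected ρ w), (adj_parent hT.connected hw0).symm⟩,
        ⟨(parent hT.connected ρ w, w), adj_parent hT.connected hw0⟩} := by
    rw [Set.disjoint_left]
    rintro e ⟨h2, h3⟩ (rfl | rfl)
    · change T.dist ρ w ≤ n at h2
      omega
    · change T.dist ρ w ≤ n at h3
      omega
  have hind := indep_iSup_of_disjoint (fun e => (measurable_pi_apply e).comap_le) hi hd
  have hle1 := (measurable_weight_coord hT hf hf0 (adj_parent hT.connected hw0)).comap_le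
  have hle2 := (measurable_killedWeight_coord (L := L) (ρ := ρ) hT hf hf0 n (parent hT.connected ρ w)
    (by omega)).comap_le
  exact indep_of_indep_of_le_left (indep_of_indep_of_le_right hind hle1) hle2

lemma map_killedWeight (hT : T.IsTree) (hf : Measurable f) (hf0 : ∀ y, f y ≠ 0) (n : ℕ) :
    ∀ w, T.dist ρ w = n → (bernoulliMeasure T ρ μ₀ μ₁).map (killedWeight hT.connected f L ρ n w) =
      killedLaw L (stepLaw μ₀ μ₁ f) n := by
  induction n with
  | zero =>
    intro w _
    change (bernoulliMeasure T ρ μ₀ μ₁).map (fun _ => 1) = _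
    rw [Measure.map_const, measure_univ, one_smul]
    rfl
  | succ n ih =>
    intro w hw
    have hw0 := ne_root_of_dist hw
    have h1 := dist_parent hT.connected hw0
    have hm1 := measurable_killedWeight (L := L) (ρ := ρ) hT hf hf0
      (w := parent hT.connected ρ w) (n := n) (by omega)
    have hm2 := measurable_weight hT.connected hf (parent hT.connected ρ w) w
    have h2 := (indepFun_iff_map_prod_eq_prod_map_map hm1.aemeasurable hm2.aemeasurable).1
      (indepFun_killedWeight (L := L) μ₀ μ₁ hT hf hf0 hw)
    rw [ih _ (by omega), map_weight_parent μ₀ μ₁ hT hf hf0 hw0] at h2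
    rw [killedLaw, ← h2, Measure.map_map (measurable_killStep L) (hm1.prodMk hm2)]
    rfl

lemma measure_killingEvent (hT : T.IsTree) (hf : Measurable f) (hf0 : ∀ y, f y ≠ 0) {n : ℕ}
    {w : V} (hw : T.dist ρ w = n + 1) :
    bernoulliMeasure T ρ μ₀ μ₁ (killingEvent hT.connected f L ρ n w) =
      ((killedLaw L (stepLaw μ₀ μ₁ f) n).prod (stepLaw μ₀ μ₁ f))
        {p | L < p.1 * NNReal.sqrt p.2} := by
  have hw0 := ne_root_of_dist hw
  have h1 := dist_parent hT.connected hw0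
  have hm1 := measurable_killedWeight (L := L) (ρ := ρ) hT hf hf0
    (w := parent hT.connected ρ w) (n := n) (by omega)
  have hm2 := measurable_weight hT.connected hf (parent hT.connected ρ w) w
  have h2 := (indepFun_iff_map_prod_eq_prod_map_map hm1.aemeasurable hm2.aemeasurable).1
    (indepFun_killedWeight (L := L) μ₀ μ₁ hT hf hf0 hw)
  rw [map_killedWeight μ₀ μ₁ hT hf hf0 n _ (by omega), map_weight_parent μ₀ μ₁ hT hf hf0 hw0] at h2
  rw [← h2, Measure.map_apply (hm1.prodMk hm2)]
  · rfl
  · exact (measurable_fst.mul (NNReal.continuous_sqrt.measurable.comp measurable_snd))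
      measurableSet_Ioi

/-- At criticality, the weights are almost surely summable over the whole tree. -/
theorem ae_tsum_weight_ne_top (hT : T.IsTree) {d : ℕ} (hd : 2 ≤ d)
    (hreg : T.IsRegularOfDegree (d + 1)) (hf : Measurable f) (hf0 : ∀ y, f y ≠ 0)
    (h1 : ∫⁻ y, (y : ℝ≥0∞) ∂(stepLaw μ₀ μ₁ f) = 1)
    (hsqrt : d * ∫⁻ y, (NNReal.sqrt y : ℝ≥0∞) ∂(stepLaw μ₀ μ₁ f) = 1) :
    ∀ᵐ x ∂(bernoulliMeasure T ρ μ₀ μ₁), ∑' v, (weight hT.connected f x ρ v : ℝ≥0∞) ≠ ∞ := by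
  have hV : Countable V := countable_of_locallyFinite hT.connected
  have hν := isProbabilityMeasure_stepLaw μ₀ μ₁ hf
  set ν := stepLaw μ₀ μ₁ f with hνdef
  set P := bernoulliMeasure T ρ μ₀ μ₁ with hP
  -- Divergence forces a killing almost surely, and a union bound over spheres of size at most 2dⁿ
  -- controls the killings.
  have hbound (L : ℝ≥0) (hL : 1 ≤ L) :
      L * P {x | ¬ (∑' v, (weight hT.connected f x ρ v : ℝ≥0∞) ≠ ∞)} ≤ 2 := by
    let b (w : V) : (T.Dart → X₀) → ℝ≥0 := killedWeight hT.connected f L ρ (T.dist ρ w) w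
    have hb (w : V) : Measurable (b w) := measurable_killedWeight hT hf hf0 rfl
    have hfin : ∀ᵐ x ∂P, ∑' w, (b w x : ℝ≥0∞) ^ 2 ≠ ∞ := by
      have hm (w : V) : Measurable fun x => (b w x : ℝ≥0∞) ^ 2 :=
        (hb w).coe_nnreal_ennreal.pow_const 2
      have h2 : ∫⁻ x, ∑' w, (b w x : ℝ≥0∞) ^ 2 ∂P ≠ ∞ := by
        rw [lintegral_tsum fun w => (hm w).aemeasurable]
        have h3 (w : V) : ∫⁻ x, (b w x : ℝ≥0∞) ^ 2 ∂P =
            (fun n => ∫⁻ z, (z : ℝ≥0∞) ^ 2 ∂(killedLaw L ν n)) (T.dist ρ w) := by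
          simp only
          rw [← map_killedWeight μ₀ μ₁ hT hf hf0 _ w rfl,
            lintegral_map (measurable_coe_nnreal_ennreal.pow_const 2) (hb w)]
        simp_rw [h3]
        refine ne_top_of_le_ne_top ?_ (tsum_dist_le hT.connected (by omega) hreg ρ
          fun n => ∫⁻ z, (z : ℝ≥0∞) ^ 2 ∂(killedLaw L ν n))
        exact ENNReal.mul_ne_top (by simp) (tsum_killedLaw_sq_ne_top hd h1 hsqrt hL)
      filter_upwards [ae_lt_top (Measurable.tsum hm) h2] with x hx using hx.ne
    let K (w : V) : Set (T.Dart → X₀) :=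
      {x | ∃ n, T.dist ρ w = n + 1 ∧ x ∈ killingEvent hT.connected f L ρ n w}
    have hsub : P {x | ¬ (∑' v, (weight hT.connected f x ρ v : ℝ≥0∞) ≠ ∞)} ≤ P (⋃ w, K w) := by
      refine measure_mono_ae ?_
      filter_upwards [hfin] with x hx hx'
      by_contra hn
      refine hx' ?_
      have h4 := killedWeight_sq_eq (L := L) (ρ := ρ) hT hf0 (x := x) fun n w hw hk =>
        hn (Set.mem_iUnion.2 ⟨w, n, hw, hk⟩)
      have h5 (v : V) : (weight hT.connected f x ρ v : ℝ≥0∞) = (b v x : ℝ≥0∞) ^ 2 := by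
        rw [← h4 _ v rfl, ENNReal.coe_pow]
      simp_rw [h5]
      exact hx
    -- The root is never killed, hence the value 0 there; a killing at distance `n + 1` involves the
    -- chain after `n` steps.
    let φ : ℕ → ℝ≥0∞
      | 0 => 0
      | n + 1 => ((killedLaw L ν n).prod ν) {p | L < p.1 * NNReal.sqrt p.2}
    have hK (w : V) : P (K w) ≤ φ (T.dist ρ w) := by
      rcases h : T.dist ρ w with _ | n
      · have : K w = ∅ := Set.eq_empty_of_forall_notMem fun x ⟨n, hn, _⟩ => by omega
        rw [this, measure_empty]
      · change _ ≤ ((killedLaw L ν n).prod ν) {p | L < p.1 * NNReal.sqrt p.2}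
        rw [← measure_killingEvent μ₀ μ₁ hT hf hf0 h]
        refine measure_mono fun x ⟨m, hm, hx⟩ => ?_
        obtain rfl : m = n := by omega
        exact hx
    calc L * P {x | ¬ (∑' v, (weight hT.connected f x ρ v : ℝ≥0∞) ≠ ∞)}
        ≤ L * ∑' w, φ (T.dist ρ w) := by
          gcongr
          exact (hsub.trans (measure_iUnion_le _)).trans (ENNReal.tsum_le_tsum hK)
      _ ≤ L * (2 * ∑' n, (d : ℝ≥0∞) ^ n * φ n) := by
          gcongr
          exact tsum_dist_le hT.connected (by omega) hreg ρ φ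
      _ = 2 * (L * ∑' n, (d : ℝ≥0∞) ^ (n + 1) * φ (n + 1)) := by
          rw [tsum_eq_zero_add' ENNReal.summable]
          simp only [φ, mul_zero, zero_add]
          ring
      _ ≤ 2 * 1 := by
          gcongr
          exact tsum_killing_le hsqrt
      _ = 2 := mul_one 2
  rw [ae_iff]
  by_contra hne
  -- The bound holds for every `L ≥ 1`, so a positive probability is contradicted by a large `L`; `n
  -- + 1` ensures `L ≥ 1`.
  obtain ⟨n, hn⟩ := ENNReal.exists_nat_mul_gt hne (b := 2) (by simp)
  have h6 := hbound (n + 1 : ℕ) (by push_cast; exact le_add_self)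
  refine absurd (hn.trans_le (le_trans ?_ h6)) (lt_irrefl _)
  gcongr
  push_cast
  exact le_self_add

end KilledWeight

/-! ### Moments of one step. -/

section StepLaw

variable {X₀ : Type*} [MeasurableSpace X₀] (μ₀ μ₁ : Measure X₀) [IsProbabilityMeasure μ₀]
  [IsProbabilityMeasure μ₁] {f : X₀ → ℝ≥0}

lemma lintegral_stepLaw (hf : Measurable f) :
    ∫⁻ y, (y : ℝ≥0∞) ∂(stepLaw μ₀ μ₁ f) =
      (∫⁻ y, (f y : ℝ≥0∞) ∂μ₀) * ∫⁻ y, ((f y)⁻¹ : ℝ≥0) ∂μ₁ := by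
  rw [stepLaw, lintegral_map measurable_coe_nnreal_ennreal (measurable_div_comp hf),
    ← lintegral_prod_mul (g := fun y => ((f y)⁻¹ : ℝ≥0)) hf.coe_nnreal_ennreal.aemeasurable
      (hf.inv.coe_nnreal_ennreal).aemeasurable]
  refine lintegral_congr fun p => ?_
  rw [div_eq_mul_inv, ENNReal.coe_mul]

lemma lintegral_sqrt_stepLaw (hf : Measurable f) :
    ∫⁻ y, (NNReal.sqrt y : ℝ≥0∞) ∂(stepLaw μ₀ μ₁ f) =
      (∫⁻ y, (NNReal.sqrt (f y) : ℝ≥0∞) ∂μ₀) * ∫⁻ y, (NNReal.sqrt (f y)⁻¹ : ℝ≥0∞) ∂μ₁ := by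
  have hs := NNReal.continuous_sqrt.measurable
  rw [stepLaw, lintegral_map hs.coe_nnreal_ennreal (measurable_div_comp hf),
    ← lintegral_prod_mul (f := fun y => (NNReal.sqrt (f y) : ℝ≥0∞))
      (g := fun y => (NNReal.sqrt (f y)⁻¹ : ℝ≥0∞)) (hs.comp hf).coe_nnreal_ennreal.aemeasurable
      (hs.comp hf.inv).coe_nnreal_ennreal.aemeasurable]
  refine lintegral_congr fun p => ?_
  rw [div_eq_mul_inv, NNReal.sqrt_mul, ENNReal.coe_mul]

end StepLaw

end TreeBernoulli

end

theorem proposition4p4 {V : Type*} (T : SimpleGraph V) [T.LocallyFinite] (hT : T.IsTree)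
    (q : ℕ) (hq : 3 ≤ q) (hreg : T.IsRegularOfDegree q) (ρ : V)
    (G : Subgroup (T ≃g T)) (hG : IsClosed (G : Set (T ≃g T)))
    (hδ : TreeBernoulli.poincareExponent G ρ = Real.log ((q : ℝ) - 1))
    {X₀ : Type*} [MeasurableSpace X₀] [StandardBorelSpace X₀]
    (μ₀ μ₁ : Measure X₀) [IsProbabilityMeasure μ₀] [IsProbabilityMeasure μ₁]
    (h01 : μ₀ ≪ μ₁) (h10 : μ₁ ≪ μ₀)
    (hcrit : 1 - TreeBernoulli.hellingerSq μ₀ μ₁ = ((q : ℝ) - 1) ^ (-(1 / 2) : ℝ)) :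
    TreeBernoulli.IsDissipativeUpToCompactStabilizers G
      (TreeBernoulli.bernoulliMeasure T ρ μ₀ μ₁) := by
  obtain ⟨d, rfl⟩ : ∃ d, q = d + 1 := ⟨q - 1, by omega⟩
  obtain ⟨f, hf, hf0, h1, h2, h3, h4⟩ := TreeBernoulli.exists_pos_density μ₀ μ₁ h01 h10
  refine TreeBernoulli.isDissipative_of_summable hT hG ρ μ₀ μ₁ h01 h10 hf hf0
    (TreeBernoulli.ae_tsum_weight_ne_top μ₀ μ₁ hT (by omega) hreg hf hf0 ?_ ?_)
  · rw [TreeBernoulli.lintegral_stepLaw μ₀ μ₁ hf, h1, h2, one_mul]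
  · have hd : (0 : ℝ) < d := by exact_mod_cast (by omega : 0 < d)
    have h5 : ((d + 1 : ℕ) : ℝ) - 1 = d := by push_cast; ring
    -- Each of the two darts of an edge contributes one Hellinger affinity, so E[√Y] is the square
    -- of `d ^ (-1/2)`, exactly balancing the branching number `d`.
    have h6 : (d : ℝ) ^ (-(1 / 2) : ℝ) * (d : ℝ) ^ (-(1 / 2) : ℝ) = (d : ℝ)⁻¹ := by
      rw [← Real.rpow_add hd, ← Real.rpow_neg_one]
      norm_num
    rw [TreeBernoulli.lintegral_sqrt_stepLaw μ₀ μ₁ hf, h3, h4, hcrit, h5,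
      ← ENNReal.ofReal_mul (by positivity), h6, ← ENNReal.ofReal_natCast d,
      ← ENNReal.ofReal_mul hd.le, mul_inv_cancel₀ hd.ne', ENNReal.ofReal_one]
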